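/- Let $n\ge 2$ and $m\ge 1$ be integers and let $0<\alpha<2$. Write $[\alpha]$ for the integer part of $\alpha$ and $\{\alpha\}=\alpha-[\alpha]$. Let $u:\mathbb R^n\to\mathbb R$ satisfy $u\ge 0$, $\int_{\mathbb R^n}\frac{|u(x)|}{1+|x|^{n+\alpha}}\,dx<\infty$, and $u\in C^{2m+[\alpha],\{\alpha\}+\epsilon}_{\rm loc}(\mathbb R^n)$ for some $\epsilon>0$ with $\{\alpha\}+\epsilon\le 1$; that is, $u$ is of class $C^{2m+[\alpha]}$ and its derivative of order $2m+[\alpha]$ is Hölder continuous with exponent $\{\alpha\}+\epsilon$ on every compact set. Put $$(-\Delta)^{\alpha/2}u(x)=C_{n,\alpha}\lim_{\delta\to0^+}\int_{|y-x|\ge\delta}\frac{u(x)-u(y)}{|x-y|^{n+\alpha}}\,dy,\qquad C_{n,\alpha}=\frac{2^{\alpha}\,\Gamma(\frac{n+\alpha}{2})}{\pi^{n/2}\,|\Gamma(-\frac{\alpha}{2})|},$$ and $(-\Delta)^{i+\alpha/2}u:=(-\Delta)^i(-\Delta)^{\alpha/2}u$ for integers $i\ge0$. Suppose that $$(-\Delta)^{m+\alpha/2}u(x)=f\big(x,u(x),Du(x),\dots,D^{2m+[\alpha]}u(x)\big)\qquad\text{for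 all }x\in\mathbb R^n,$$ where $f$ is a real-valued function such that the right-hand side is nonnegative and continuous as a function of $x\in\mathbb R^n$. Then the integrals and the limit defining $(-\Delta)^{\alpha/2}u(x)$ converge for every $x\in\mathbb R^n$, the function $(-\Delta)^{\alpha/2}u$ is of class $C^{2m}$, and $$(-\Delta)^{i+\alpha/2}u(x)\ge 0\qquad\text{for all }x\in\mathbb R^n\text{ and every } i=0,1,\dots,m-1.$$ -/

import Mathlib

open MeasureTheory Filter Topology

noncomputable section

/-- `n`-dimensional Euclidean space. -/
abbrev Rn (n : ℕ) : Type := EuclideanSpace ℝ (Fin n)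

/-- `C^{k,β}_loc(ℝⁿ)`: functions of class `C^k` whose `k`-th derivative is `β`-Hölder continuous
on every compact set. -/
def IsLocHolder {n : ℕ} (k : ℕ) (β : ℝ) (u : Rn n → ℝ) : Prop :=
  ContDiff ℝ (k : ℕ) u ∧
    ∀ K : Set (Rn n), IsCompact K → ∃ C : ℝ, ∀ x ∈ K, ∀ y ∈ K,
      ‖iteratedFDeriv ℝ k u x - iteratedFDeriv ℝ k u y‖ ≤ C * ‖x - y‖ ^ β

/-- The space `𝓛_α(ℝⁿ)`: `∫ |u(x)| / (1 + |x|^{n+α}) dx < ∞`. -/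
def MemLAlpha {n : ℕ} (α : ℝ) (u : Rn n → ℝ) : Prop :=
  Integrable (fun x : Rn n => |u x| / (1 + ‖x‖ ^ ((n : ℝ) + α))) volume

/-- The usual normalization constant `C_{n,α} = 2^α Γ((n+α)/2) / (π^{n/2} |Γ(-α/2)|)`, with
`|Γ(-α/2)| = Γ(1-α/2) / (α/2)` for `0 < α < 2`. -/
def fracConst (n : ℕ) (α : ℝ) : ℝ :=
  2 ^ α * (α / 2) * Real.Gamma (((n : ℝ) + α) / 2) /
    (Real.pi ^ ((n : ℝ) / 2) * Real.Gamma (1 - α / 2))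

/-- The integrand `(u(x) - u(y)) / |x - y|^{n+α}`, as a function of `y`. -/
def fracIntegrand {n : ℕ} (α : ℝ) (u : Rn n → ℝ) (x y : Rn n) : ℝ :=
  (u x - u y) / ‖x - y‖ ^ ((n : ℝ) + α)

/-- The truncated integral `C_{n,α} ∫_{|y-x| ≥ δ} (u(x) - u(y)) / |x - y|^{n+α} dy`. -/
def fracTrunc {n : ℕ} (α : ℝ) (u : Rn n → ℝ) (x : Rn n) (δ : ℝ) : ℝ :=
  fracConst n α * ∫ y in {y : Rn n | δ ≤ ‖y - x‖}, fracIntegrand α u x y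

/-- The fractional Laplacian `(-Δ)^{α/2} u (x)`, as a principal value. -/
def fracLaplacian {n : ℕ} (α : ℝ) (u : Rn n → ℝ) (x : Rn n) : ℝ :=
  limUnder (𝓝[>] (0 : ℝ)) (fracTrunc α u x)

/-- The principal value defining `(-Δ)^{α/2} u (x)` genuinely exists and equals `L`: all
truncated integrals converge absolutely and they tend to `L`. -/
def HasFracLaplacianAt {n : ℕ} (α : ℝ) (u : Rn n → ℝ) (x : Rn n) (L : ℝ) : Prop :=
  (∀ δ : ℝ, 0 < δ → IntegrableOn (fracIntegrand α u x) {y : Rn n | δ ≤ ‖y - x‖} volume) ∧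
    Tendsto (fracTrunc α u x) (𝓝[>] (0 : ℝ)) (𝓝 L)

/-- `-Δ`, acting on functions on `ℝⁿ`. -/
def negLaplacian {n : ℕ} (v : Rn n → ℝ) : Rn n → ℝ :=
  fun x => -(Laplacian.laplacian v x)

/-- `(-Δ)^{i+α/2} u := (-Δ)^i (-Δ)^{α/2} u`. -/
def higherFracLaplacian {n : ℕ} (i : ℕ) (α : ℝ) (u : Rn n → ℝ) : Rn n → ℝ :=
  negLaplacian^[i] (fracLaplacian α u)

/-- The possible values of `(u, Du, …, D^N u)` at a point of `ℝⁿ`. -/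
abbrev JetValue (n N : ℕ) : Type :=
  (k : Fin (N + 1)) → ContinuousMultilinearMap ℝ (fun _ : Fin (k : ℕ) => Rn n) ℝ

/-- `(u(x), Du(x), …, D^N u(x))`. -/
def jet {n : ℕ} (N : ℕ) (u : Rn n → ℝ) (x : Rn n) : JetValue n N :=
  fun k => iteratedFDeriv ℝ (k : ℕ) u x

end

/-! Put `w = (-Δ)^{α/2} u`. The theorem rests on one fact at infinity: the averages of `w` against
rescaled test functions `r^{-n} φ((z - x₀)/r)` tend to zero as `r → ∞`. Indeed, the operator is
symmetric, so it can be moved onto the test function. Since `(-Δ)^{α/2} φ = O((1 + |x|)^{-n-α})`,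
homogeneity of the kernel bounds the average by `A ∫ |u(z)| (r + |z - x₀|)^{-n-α} dz`, which tends
to zero by dominated convergence because `u ∈ 𝓛_α` (`tendsto_average_fracLaplacian`).

Vanishing averages are inherited by `-Δw`, because Green's identity puts the Laplacian on `φ` at the
price of a factor `r^{-2}` (`VanishingAverages.negLaplacian`). On the other hand, a `C²`
superharmonic function has radial averages that decrease with the radius. If these tend to zero, the
value at the centre, which is the average at radius zero, is nonnegative
(`VanishingAverages.nonneg`). A smooth radial weight replaces spherical means, so no surface measure
is needed. Starting from `(-Δ)^m w ≥ 0`, downward induction gives `(-Δ)^i w ≥ 0` for every `i ≤ m`.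

It remains to justify that `w` exists and is `C^{2m}` (`contDiff_fracLaplacian`). After
symmetrization in `z ↦ -z` the principal value is an absolutely convergent integral of second
differences. Near the origin it can be differentiated `2m` times, because `D^{2m} u` still has
second differences of order `⌊α⌋ + {α} + ε > α`. Away from the origin it is a convolution with the
truncated kernel, whose smoothness comes from `u` on bounded sets and from the kernel at infinity.
-/

noncomputable section

/-! ### Integrability of radial powers -/

section Kernel

variable {n : ℕ}

lemma integrableOn_ball_norm_rpow (hn : 0 < n) {γ : ℝ} (hγ : -(n : ℝ) < γ) :
    IntegrableOn (fun z : Rn n => ‖z‖ ^ γ) (Metric.ball 0 1) := by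
  have : NeZero n := ⟨hn.ne'⟩
  have : Nontrivial (Rn n) := inferInstance
  rw [integrableOn_fun_norm_addHaar (f := fun y : ℝ => y ^ γ) volume]
  have h : IntegrableOn (fun y : ℝ => y ^ (γ + (n - 1 : ℝ))) (Set.Ioo 0 1) := by
    rw [intervalIntegral.integrableOn_Ioo_rpow_iff one_pos]; linarith
  refine h.congr_fun (fun y hy => ?_) measurableSet_Ioo
  have hy0 : 0 < y := hy.1
  simp only [finrank_euclideanSpace, Fintype.card_fin, smul_eq_mul]
  rw [Real.rpow_add hy0, mul_comm, ← Real.rpow_natCast, Nat.cast_sub hn, Nat.cast_one]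

lemma norm_rpow_inv_le_one_add {δ s : ℝ} (hδ : 0 < δ) (hs : 0 ≤ s) {z : Rn n} (hz : δ ≤ ‖z‖) :
    (‖z‖ ^ s)⁻¹ ≤ (1 + δ⁻¹) ^ s * (1 + ‖z‖) ^ (-s) := by
  have hz0 : 0 < ‖z‖ := hδ.trans_le hz
  have h1 : 1 + ‖z‖ ≤ (1 + δ⁻¹) * ‖z‖ := by
    have : 1 ≤ δ⁻¹ * ‖z‖ := by
      rw [inv_mul_eq_div, le_div_iff₀ hδ]; linarith
    linarith
  have h2 : (1 + ‖z‖) ^ s ≤ (1 + δ⁻¹) ^ s * ‖z‖ ^ s := by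
    rw [← Real.mul_rpow (by positivity) hz0.le]
    exact Real.rpow_le_rpow (by positivity) h1 hs
  rw [Real.rpow_neg (by positivity), ← div_eq_mul_inv, le_div_iff₀ (by positivity),
    inv_mul_le_iff₀ (by positivity)]
  linarith

lemma measurableSet_le_norm (δ : ℝ) : MeasurableSet {z : Rn n | δ ≤ ‖z‖} :=
  measurableSet_le measurable_const measurable_norm

lemma integrable_one_add_norm_rpow {s : ℝ} (hs : (n : ℝ) < s) :
    Integrable (fun z : Rn n => (1 + ‖z‖) ^ (-s)) :=
  integrable_one_add_norm (by simpa using hs)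

lemma integrableOn_ball_norm_rpow_div (hn : 0 < n) {γ s : ℝ} (h : s < n + γ) :
    IntegrableOn (fun z : Rn n => (‖z‖ ^ s)⁻¹ * ‖z‖ ^ γ) (Metric.ball 0 1) := by
  have := integrableOn_ball_norm_rpow hn (γ := γ - s) (by linarith)
  refine IntegrableOn.congr_fun_ae this ?_
  have h0 : ∀ᵐ z : Rn n ∂(volume.restrict (Metric.ball 0 1)), z ≠ 0 := by
    have : NeZero n := ⟨hn.ne'⟩
    have : Nontrivial (Rn n) := inferInstance
    exact ae_restrict_of_ae (Measure.ae_ne volume 0)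
  filter_upwards [h0] with z hz
  rw [Real.rpow_sub (norm_pos_iff.2 hz), div_eq_inv_mul]

end Kernel

/-! ### Local Hölder classes and second differences -/

section SecondDiff

variable {n : ℕ} {F : Type} [NormedAddCommGroup F]

/-- The symmetric second difference `2 g(x) - g(x+z) - g(x-z)`. -/
def secondDiff (g : Rn n → F) (x z : Rn n) : F := (g x - g (x + z)) + (g x - g (x - z))

/-- Second differences are `O(|z|^γ)`, locally uniformly. -/
def LocSecondDiff (γ : ℝ) (g : Rn n → F) : Prop :=
  ∀ R : ℝ, ∃ C : ℝ, 0 ≤ C ∧ ∀ x z : Rn n, ‖x‖ ≤ R → ‖z‖ ≤ 1 → ‖secondDiff g x z‖ ≤ C * ‖z‖ ^ γ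

lemma continuous_secondDiff {g : Rn n → F} (hg : Continuous g) :
    Continuous fun p : Rn n × Rn n => secondDiff g p.1 p.2 := by
  unfold secondDiff; fun_prop

variable [NormedSpace ℝ F]

/-- The vector-valued version of `IsLocHolder`. -/
def LocHolder (k : ℕ) (β : ℝ) (g : Rn n → F) : Prop :=
  ContDiff ℝ (k : ℕ) g ∧
    ∀ K : Set (Rn n), IsCompact K → ∃ C : ℝ, ∀ x ∈ K, ∀ y ∈ K,
      ‖iteratedFDeriv ℝ k g x - iteratedFDeriv ℝ k g y‖ ≤ C * ‖x - y‖ ^ β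

lemma exists_lipschitz_of_contDiff {g : Rn n → F} (hg : ContDiff ℝ 1 g) (R : ℝ) :
    ∃ C : ℝ, 0 ≤ C ∧ ∀ x y : Rn n, ‖x‖ ≤ R → ‖y‖ ≤ R → ‖g x - g y‖ ≤ C * ‖x - y‖ := by
  obtain ⟨C, hC⟩ := (isCompact_closedBall (0 : Rn n) R).exists_bound_of_continuousOn
    (hg.continuous_fderiv one_ne_zero).continuousOn
  refine ⟨|C|, abs_nonneg _, fun x y hx hy => ?_⟩
  exact (convex_closedBall (0 : Rn n) R).norm_image_sub_le_of_norm_fderiv_le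
    (fun z _ => hg.differentiable one_ne_zero z) (fun z hz => (hC z hz).trans (le_abs_self C))
    (by simpa using hy) (by simpa using hx)

/-- The `k`-th derivative is `C¹`, hence Lipschitz on bounded sets, and there `|x - y| ≤ (2R)^{1-β}
|x - y|^β` because `β ≤ 1`. -/
lemma LocHolder.of_succ {k : ℕ} {β : ℝ} (hβ1 : β ≤ 1) {g : Rn n → F}
    (hg : LocHolder (k + 1) β g) : LocHolder k β g := by
  refine ⟨hg.1.of_le (by exact_mod_cast Nat.le_succ k), fun K hK => ?_⟩
  obtain ⟨R, hR⟩ := hK.isBounded.exists_norm_le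
  have h1 : ContDiff ℝ 1 (iteratedFDeriv ℝ k g) :=
    hg.1.iteratedFDeriv_right (by exact_mod_cast (add_comm 1 k).le)
  obtain ⟨C, hC0, hC⟩ := exists_lipschitz_of_contDiff h1 R
  refine ⟨C * (2 * R) ^ (1 - β), fun x hx y hy => (hC x y (hR x hx) (hR y hy)).trans ?_⟩
  rw [mul_assoc]
  refine mul_le_mul_of_nonneg_left ?_ hC0
  rcases (norm_nonneg (x - y)).eq_or_lt with h | h
  · rw [← h]
    have := (norm_nonneg x).trans (hR x hx)
    positivity
  · calc ‖x - y‖ = ‖x - y‖ ^ (1 - β) * ‖x - y‖ ^ β := by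
          rw [← Real.rpow_add h, sub_add_cancel, Real.rpow_one]
      _ ≤ _ := by
          refine mul_le_mul_of_nonneg_right (Real.rpow_le_rpow h.le ?_ (by linarith))
            (by positivity)
          have := norm_sub_le x y
          linarith [hR x hx, hR y hy]

lemma LocHolder.of_add {k j : ℕ} {β : ℝ} (hβ1 : β ≤ 1) {g : Rn n → F}
    (hg : LocHolder (j + k) β g) : LocHolder k β g := by
  induction j with
  | zero => simpa using hg
  | succ j ih => exact ih (LocHolder.of_succ hβ1 (by simpa [add_right_comm] using hg))

lemma LocHolder.fderiv {k : ℕ} {β : ℝ} {g : Rn n → F}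
    (hg : LocHolder (k + 1) β g) : LocHolder k β (fderiv ℝ g) := by
  refine ⟨hg.1.fderiv_right (by norm_cast), fun K hK => ?_⟩
  obtain ⟨C, hC⟩ := hg.2 K hK
  refine ⟨C, fun x hx y hy => ?_⟩
  have := hC x hx y hy
  rwa [iteratedFDeriv_succ_eq_comp_right, iteratedFDeriv_succ_eq_comp_right, Function.comp_apply,
    Function.comp_apply, ← dist_eq_norm, LinearIsometryEquiv.dist_map, dist_eq_norm] at this

lemma LocHolder.norm_sub_le {β : ℝ} {g : Rn n → F} (hg : LocHolder 0 β g) (R : ℝ) :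
    ∃ C : ℝ, 0 ≤ C ∧ ∀ x y : Rn n, ‖x‖ ≤ R → ‖y‖ ≤ R → ‖g x - g y‖ ≤ C * ‖x - y‖ ^ β := by
  obtain ⟨C, hC⟩ := hg.2 _ (isCompact_closedBall (0 : Rn n) R)
  refine ⟨|C|, abs_nonneg C, fun x y hx hy => ?_⟩
  have := hC x (by simpa using hx) y (by simpa using hy)
  rw [iteratedFDeriv_zero_eq_comp, Function.comp_apply, Function.comp_apply, ← map_sub,
    LinearIsometryEquiv.norm_map] at this
  exact this.trans (mul_le_mul_of_nonneg_right (le_abs_self C) (by positivity))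

lemma LocHolder.locSecondDiff_zero {β : ℝ} {g : Rn n → F} (hg : LocHolder 0 β g) :
    LocSecondDiff β g := by
  intro R
  obtain ⟨C, hC0, hC⟩ := hg.norm_sub_le (R + 1)
  refine ⟨2 * C, by positivity, fun x z hx hz => ?_⟩
  have h1 := hC x (x + z) (by linarith) ((norm_add_le x z).trans (by linarith))
  have h2 := hC x (x - z) (by linarith) ((_root_.norm_sub_le x z).trans (by linarith))
  rw [show x - (x + z) = -z by abel, norm_neg] at h1
  rw [show x - (x - z) = z by abel] at h2
  calc _ ≤ _ := norm_add_le _ _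
    _ ≤ _ := by linarith

/-- Mean value inequality along `t ↦ secondDiff g x (t • z)`: the first-order terms of the two
increments cancel, so only the oscillation of the derivative enters. -/
lemma norm_secondDiff_le_of_fderiv {g : Rn n → F} (hg : Differentiable ℝ g) {x z : Rn n} {B : ℝ}
    (hB : ∀ t ∈ Set.Icc (0 : ℝ) 1, ‖fderiv ℝ g (x + t • z) - fderiv ℝ g (x - t • z)‖ ≤ B) :
    ‖secondDiff g x z‖ ≤ B * ‖z‖ := by
  have hd : ∀ t : ℝ, HasDerivAt (fun t : ℝ => secondDiff g x (t • z))
      (-(fderiv ℝ g (x + t • z) - fderiv ℝ g (x - t • z)) z) t := by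
    intro t
    have ht : HasDerivAt (fun t : ℝ => t • z) z t := by
      simpa using (hasDerivAt_id t).smul_const z
    have h1 := ((hg (x + t • z)).hasFDerivAt.comp_hasDerivAt t (ht.const_add x)).const_sub (g x)
    have h2 := ((hg (x - t • z)).hasFDerivAt.comp_hasDerivAt t (ht.const_sub x)).const_sub (g x)
    convert! h1.add h2 using 1
    simp [map_neg]; abel
  have := (convex_Icc (0 : ℝ) 1).norm_image_sub_le_of_norm_hasDerivWithin_le (C := B * ‖z‖)
    (fun t _ => (hd t).hasDerivWithinAt) (fun t ht => ?_) (Set.left_mem_Icc.2 zero_le_one)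
    (Set.right_mem_Icc.2 zero_le_one)
  · simpa [secondDiff] using this
  · rw [norm_neg]
    exact (ContinuousLinearMap.le_opNorm _ _).trans
      (mul_le_mul_of_nonneg_right (hB t ht) (norm_nonneg z))

lemma LocHolder.locSecondDiff_one {β : ℝ} (hβ : 0 < β) {g : Rn n → F} (hg : LocHolder 1 β g) :
    LocSecondDiff (1 + β) g := by
  intro R
  obtain ⟨C, hC0, hC⟩ := (LocHolder.fderiv (k := 0) hg).norm_sub_le (R + 1)
  refine ⟨C * 2 ^ β, by positivity, fun x z hx hz => ?_⟩
  -- The points `x ± t • z` are at distance at most `2‖z‖`, whence the factor `2 ^ β`.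
  refine (norm_secondDiff_le_of_fderiv (B := C * 2 ^ β * ‖z‖ ^ β)
    (hg.1.differentiable (by simp)) (fun t ht => ?_)).trans (le_of_eq ?_)
  · have htz : ‖t • z‖ ≤ ‖z‖ := by
      rw [norm_smul, Real.norm_of_nonneg ht.1]
      exact mul_le_of_le_one_left (norm_nonneg z) ht.2
    refine (hC _ _ ((norm_add_le _ _).trans (by linarith))
      ((_root_.norm_sub_le _ _).trans (by linarith))).trans ?_
    rw [mul_assoc, ← Real.mul_rpow zero_le_two (norm_nonneg z)]
    refine mul_le_mul_of_nonneg_left (Real.rpow_le_rpow (norm_nonneg _) ?_ hβ.le) hC0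
    rw [show x + t • z - (x - t • z) = t • z + t • z by abel]
    exact (norm_add_le _ _).trans (by linarith)
  · rcases (norm_nonneg z).eq_or_lt with h | h
    · rw [← h, Real.zero_rpow (show 1 + β ≠ 0 by positivity)]; simp
    · rw [Real.rpow_add h, Real.rpow_one]; ring

lemma LocHolder.locSecondDiff {a : ℕ} (ha : a ≤ 1) {β : ℝ} (hβ : 0 < β) {g : Rn n → F}
    (hg : LocHolder a β g) : LocSecondDiff (a + β) g := by
  interval_cases a
  · simpa using hg.locSecondDiff_zero
  · simpa using hg.locSecondDiff_one hβ

lemma hasFDerivAt_secondDiff {g : Rn n → F} (hg : Differentiable ℝ g) (x z : Rn n) :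
    HasFDerivAt (fun x => secondDiff g x z) (secondDiff (fderiv ℝ g) x z) x := by
  have h0 := (hg x).hasFDerivAt
  have h1 := (hg (x + z)).hasFDerivAt.comp x ((hasFDerivAt_id x).add_const z)
  have h2 := (hg (x - z)).hasFDerivAt.comp x ((hasFDerivAt_id x).sub_const z)
  exact (h0.sub h1).add (h0.sub h2)

/-- The singular part `∫_{|z|<1} (2g(x) - g(x+z) - g(x-z)) / |z|^s dz`. -/
def nearPart (s : ℝ) (g : Rn n → F) (x : Rn n) : F :=
  ∫ z in Metric.ball (0 : Rn n) 1, (‖z‖ ^ s)⁻¹ • secondDiff g x z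

lemma aestronglyMeasurable_near {g : Rn n → F} (hg : Continuous g) (s : ℝ) (x : Rn n)
    (μ : Measure (Rn n)) :
    AEStronglyMeasurable (fun z : Rn n => (‖z‖ ^ s)⁻¹ • secondDiff g x z) μ := by
  have h1 : Measurable fun z : Rn n => (‖z‖ ^ s)⁻¹ := by fun_prop
  have h2 : Continuous fun z : Rn n => secondDiff g x z :=
    (continuous_secondDiff hg).comp (Continuous.prodMk_right x)
  exact h1.aestronglyMeasurable.smul h2.aestronglyMeasurable

lemma norm_near_le {g : Rn n → F} {x z : Rn n} {C γ s : ℝ}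
    (h : ‖secondDiff g x z‖ ≤ C * ‖z‖ ^ γ) :
    ‖(‖z‖ ^ s)⁻¹ • secondDiff g x z‖ ≤ C * ((‖z‖ ^ s)⁻¹ * ‖z‖ ^ γ) := by
  rw [norm_smul, Real.norm_of_nonneg (by positivity)]
  calc _ ≤ (‖z‖ ^ s)⁻¹ * (C * ‖z‖ ^ γ) := mul_le_mul_of_nonneg_left h (by positivity)
    _ = _ := by ring

lemma integrableOn_near (hn : 0 < n) {γ s : ℝ} (h : s < n + γ) {g : Rn n → F}
    (hg : Continuous g) (hγ : LocSecondDiff γ g) (x : Rn n) :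
    IntegrableOn (fun z : Rn n => (‖z‖ ^ s)⁻¹ • secondDiff g x z) (Metric.ball 0 1) := by
  obtain ⟨C, -, hC⟩ := hγ ‖x‖
  refine Integrable.mono' ((integrableOn_ball_norm_rpow_div hn h).const_mul C)
    (aestronglyMeasurable_near hg s x _) ?_
  filter_upwards [ae_restrict_mem Metric.isOpen_ball.measurableSet] with z hz
  exact norm_near_le (hC x z le_rfl (by simpa using (mem_ball_zero_iff.1 hz).le))

lemma continuous_nearPart (hn : 0 < n) {γ s : ℝ} (h : s < n + γ) {g : Rn n → F}
    (hg : Continuous g) (hγ : LocSecondDiff γ g) : Continuous (nearPart s g) := by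
  rw [continuous_iff_continuousAt]
  intro x₀
  obtain ⟨C, -, hC⟩ := hγ (‖x₀‖ + 1)
  refine continuousAt_of_dominated (bound := fun z => C * ((‖z‖ ^ s)⁻¹ * ‖z‖ ^ γ))
    (.of_forall fun x => aestronglyMeasurable_near hg s x _) ?_
    ((integrableOn_ball_norm_rpow_div hn h).const_mul C) (.of_forall fun z => ?_)
  · filter_upwards [Metric.ball_mem_nhds x₀ one_pos] with x hx
    filter_upwards [ae_restrict_mem Metric.isOpen_ball.measurableSet] with z hz
    refine norm_near_le (hC x z ?_ (by simpa using (mem_ball_zero_iff.1 hz).le))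
    have := norm_le_norm_add_norm_sub' x x₀
    rw [Metric.mem_ball, dist_eq_norm] at hx
    linarith
  · have : Continuous fun x => secondDiff g x z :=
      (continuous_secondDiff hg).comp (Continuous.prodMk_left z)
    exact (this.const_smul _).continuousAt

lemma hasFDerivAt_nearPart (hn : 0 < n) {γ s : ℝ} (h : s < n + γ) {g : Rn n → F}
    (hg : ContDiff ℝ 1 g) (hγ : LocSecondDiff γ g) (hγ' : LocSecondDiff γ (fderiv ℝ g))
    (x₀ : Rn n) : HasFDerivAt (nearPart s g) (nearPart s (fderiv ℝ g) x₀) x₀ := by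
  obtain ⟨C, -, hC⟩ := hγ' (‖x₀‖ + 1)
  refine hasFDerivAt_integral_of_dominated_of_fderiv_le (Metric.ball_mem_nhds x₀ one_pos)
    (bound := fun z => C * ((‖z‖ ^ s)⁻¹ * ‖z‖ ^ γ))
    (F' := fun x z => (‖z‖ ^ s)⁻¹ • secondDiff (fderiv ℝ g) x z)
    (.of_forall fun x => aestronglyMeasurable_near hg.continuous s x _)
    (integrableOn_near hn h hg.continuous hγ x₀)
    (aestronglyMeasurable_near (hg.continuous_fderiv one_ne_zero) s x₀ _) ?_
    ((integrableOn_ball_norm_rpow_div hn h).const_mul C) (.of_forall fun z x _ => ?_)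
  · filter_upwards [ae_restrict_mem Metric.isOpen_ball.measurableSet] with z hz x hx
    refine norm_near_le (hC x z ?_ (by simpa using (mem_ball_zero_iff.1 hz).le))
    have := norm_le_norm_add_norm_sub' x x₀
    rw [Metric.mem_ball, dist_eq_norm] at hx
    linarith
  · exact (hasFDerivAt_secondDiff (hg.differentiable one_ne_zero) x z).const_smul _

/-- Second differences commute with differentiation, so the derivative of `nearPart s g` is
`nearPart s (fderiv ℝ g)`. The induction therefore runs over all target spaces `F` at once; the
order `a + β` left after `k` derivatives keeps the integrals dominated. -/
lemma contDiff_nearPart (hn : 0 < n) {a : ℕ} (ha : a ≤ 1) {β s : ℝ} (hβ : 0 < β) (hβ1 : β ≤ 1)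
    (h : s < n + (a + β)) (k : ℕ) {F : Type} [NormedAddCommGroup F] [NormedSpace ℝ F]
    {g : Rn n → F} (hg : LocHolder (k + a) β g) : ContDiff ℝ (k : ℕ) (nearPart s g) := by
  induction k generalizing F with
  | zero =>
    rw [Nat.cast_zero, contDiff_zero]
    exact continuous_nearPart hn h hg.1.continuous ((hg.of_add hβ1).locSecondDiff ha hβ)
  | succ k ih =>
    have hg' : LocHolder (k + a) β (fderiv ℝ g) :=
      LocHolder.fderiv (by simpa [add_right_comm] using hg)
    have h1 : ContDiff ℝ 1 g := hg.1.of_le (by norm_cast; omega)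
    rw [Nat.cast_succ, contDiff_succ_iff_hasFDerivAt]
    exact ⟨_, ih hg', hasFDerivAt_nearPart hn h h1 ((hg.of_add hβ1).locSecondDiff ha hβ)
      ((hg'.of_add hβ1).locSecondDiff ha hβ)⟩

end SecondDiff

/-! ### The fractional Laplacian as an absolutely convergent integral -/

section FracLaplacian

variable {n : ℕ} {α : ℝ}

/-- The kernel `|z|^{-n-α}`. -/
def fracKernel (α : ℝ) (z : Rn n) : ℝ := (‖z‖ ^ ((n : ℝ) + α))⁻¹

/-- The kernel `|z|^{-n-α}`, cut off to `|z| ≥ δ`. -/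
def truncKernel (α δ : ℝ) : Rn n → ℝ := {z : Rn n | δ ≤ ‖z‖}.indicator (fracKernel α)

lemma fracKernel_nonneg (z : Rn n) : 0 ≤ fracKernel α z := by
  unfold fracKernel; positivity

lemma truncKernel_nonneg (δ : ℝ) (z : Rn n) : 0 ≤ truncKernel α δ z :=
  Set.indicator_nonneg (fun _ _ => fracKernel_nonneg _) z

lemma truncKernel_of_le {δ : ℝ} {z : Rn n} (h : δ ≤ ‖z‖) : truncKernel α δ z = fracKernel α z :=
  Set.indicator_of_mem (s := {z : Rn n | δ ≤ ‖z‖}) h _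

lemma truncKernel_of_lt {δ : ℝ} {z : Rn n} (h : ‖z‖ < δ) : truncKernel α δ z = 0 :=
  Set.indicator_of_notMem (s := {z : Rn n | δ ≤ ‖z‖}) (not_le.2 h) _

lemma truncKernel_neg (δ : ℝ) (z : Rn n) : truncKernel α δ (-z) = truncKernel α δ z := by
  simp [truncKernel, Set.indicator, fracKernel]

lemma truncKernel_le_fracKernel (δ : ℝ) (z : Rn n) : truncKernel α δ z ≤ fracKernel α z :=
  Set.indicator_le_self' (fun _ _ => fracKernel_nonneg _) z

lemma measurable_fracKernel : Measurable (fracKernel α : Rn n → ℝ) := by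
  unfold fracKernel; fun_prop

lemma measurable_truncKernel (δ : ℝ) : Measurable (truncKernel α δ : Rn n → ℝ) :=
  measurable_fracKernel.indicator (measurableSet_le_norm δ)

lemma truncKernel_le (hα : 0 < α) {δ : ℝ} (hδ : 0 < δ) (z : Rn n) :
    truncKernel α δ z ≤ (1 + δ⁻¹) ^ ((n : ℝ) + α) * (1 + ‖z‖) ^ (-((n : ℝ) + α)) := by
  rcases le_or_gt δ ‖z‖ with h | h
  · rw [truncKernel_of_le h]
    exact norm_rpow_inv_le_one_add hδ (by positivity) h
  · rw [truncKernel_of_lt h]; positivity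

lemma integrable_truncKernel (hα : 0 < α) {δ : ℝ} (hδ : 0 < δ) :
    Integrable (truncKernel α δ : Rn n → ℝ) := by
  refine Integrable.mono' ((integrable_one_add_norm_rpow (s := (n : ℝ) + α) (by linarith)).const_mul
    ((1 + δ⁻¹) ^ ((n : ℝ) + α)))
    (measurable_truncKernel δ).aestronglyMeasurable (.of_forall fun z => ?_)
  rw [Real.norm_of_nonneg (truncKernel_nonneg δ z)]
  exact truncKernel_le hα hδ z

/-- Peetre-type inequality, from `|x + z| ≤ (1 + |z|)(1 + |x|)`. It compares a translated kernel
with the weight of `MemLAlpha`, locally uniformly in `x`. -/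
lemma one_add_norm_rpow_le {s : ℝ} (hs : 0 ≤ s) (x z : Rn n) :
    (1 + ‖z‖) ^ (-s) ≤ 2 * (1 + ‖x‖) ^ s * (1 + ‖x + z‖ ^ s)⁻¹ := by
  rw [Real.rpow_neg (by positivity), ← div_eq_mul_inv, le_div_iff₀ (by positivity),
    inv_mul_le_iff₀ (by positivity)]
  have h1 : (1 : ℝ) ≤ ((1 + ‖z‖) * (1 + ‖x‖)) ^ s := by
    refine Real.one_le_rpow ?_ hs
    nlinarith [norm_nonneg z, norm_nonneg x]
  have h2 : ‖x + z‖ ^ s ≤ ((1 + ‖z‖) * (1 + ‖x‖)) ^ s := by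
    refine Real.rpow_le_rpow (norm_nonneg _) ?_ hs
    nlinarith [norm_nonneg z, norm_nonneg x, norm_add_le x z]
  rw [Real.mul_rpow (by positivity) (by positivity)] at h1 h2
  linarith

lemma truncKernel_mul_abs_le (hα : 0 < α) {δ : ℝ} (hδ : 0 < δ) (u : Rn n → ℝ) (x z : Rn n) :
    ‖truncKernel α δ z * u (x + z)‖ ≤
      (1 + δ⁻¹) ^ ((n : ℝ) + α) * (2 * (1 + ‖x‖) ^ ((n : ℝ) + α)) *
        (|u (x + z)| / (1 + ‖x + z‖ ^ ((n : ℝ) + α))) := by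
  rw [norm_mul, Real.norm_of_nonneg (truncKernel_nonneg δ z), Real.norm_eq_abs]
  have h := (truncKernel_le hα hδ z).trans (mul_le_mul_of_nonneg_left
    (one_add_norm_rpow_le (s := (n : ℝ) + α) (by positivity) x z) (by positivity))
  calc _ ≤ _ := mul_le_mul_of_nonneg_right h (abs_nonneg _)
    _ = _ := by ring

lemma integrable_truncKernel_mul (hα : 0 < α) {δ : ℝ} (hδ : 0 < δ) {u : Rn n → ℝ}
    (hu : Continuous u) (hL : MemLAlpha α u) (x : Rn n) :
    Integrable fun z : Rn n => truncKernel α δ z * u (x + z) := by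
  refine Integrable.mono' ((hL.comp_add_left x).const_mul
    ((1 + δ⁻¹) ^ ((n : ℝ) + α) * (2 * (1 + ‖x‖) ^ ((n : ℝ) + α))))
    ((measurable_truncKernel δ).aestronglyMeasurable.mul (by fun_prop))
    (.of_forall fun z => truncKernel_mul_abs_le hα hδ u x z)

lemma integrable_truncKernel_mul' (hα : 0 < α) {δ : ℝ} (hδ : 0 < δ) {u : Rn n → ℝ}
    (hu : Continuous u) (hL : MemLAlpha α u) (x : Rn n) :
    Integrable fun z : Rn n => truncKernel α δ z * u (x - z) := by
  simpa [truncKernel_neg, sub_eq_add_neg] using (integrable_truncKernel_mul hα hδ hu hL x).comp_neg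

lemma integral_abs_truncKernel_mul_le (hα : 0 < α) {δ : ℝ} (hδ : 0 < δ) {u : Rn n → ℝ}
    (hu : Continuous u) (hL : MemLAlpha α u) (x : Rn n) :
    ∫ z : Rn n, ‖truncKernel α δ z * u (x + z)‖ ≤
      (1 + δ⁻¹) ^ ((n : ℝ) + α) * (2 * (1 + ‖x‖) ^ ((n : ℝ) + α)) *
        ∫ y : Rn n, |u y| / (1 + ‖y‖ ^ ((n : ℝ) + α)) := by
  rw [← integral_add_left_eq_self (fun y : Rn n => |u y| / (1 + ‖y‖ ^ ((n : ℝ) + α))) x,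
    ← integral_const_mul]
  exact integral_mono (integrable_truncKernel_mul hα hδ hu hL x).norm
    ((hL.comp_add_left x).const_mul _) (fun z => truncKernel_mul_abs_le hα hδ u x z)

/-- The term `x + (y - x)` is left unsimplified so that the right side is visibly a function of `y -
x`, ready for translation invariance. -/
lemma fracIntegrand_indicator (u : Rn n → ℝ) (x : Rn n) (δ : ℝ) :
    ({y : Rn n | δ ≤ ‖y - x‖}.indicator (fracIntegrand α u x)) =
      fun y => truncKernel α δ (y - x) * (u x - u (x + (y - x))) := by
  ext y
  by_cases h : δ ≤ ‖y - x‖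
  · rw [Set.indicator_of_mem (s := {y : Rn n | δ ≤ ‖y - x‖}) h, truncKernel_of_le h, fracKernel,
      fracIntegrand, norm_sub_rev, add_sub_cancel, div_eq_inv_mul]
  · rw [Set.indicator_of_notMem (s := {y : Rn n | δ ≤ ‖y - x‖}) h, truncKernel_of_lt (not_le.1 h),
      zero_mul]

lemma measurableSet_le_norm_sub (x : Rn n) (δ : ℝ) : MeasurableSet {y : Rn n | δ ≤ ‖y - x‖} :=
  measurableSet_le measurable_const (by fun_prop)

lemma integrable_truncKernel_mul_sub (hα : 0 < α) {δ : ℝ} (hδ : 0 < δ) {u : Rn n → ℝ}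
    (hu : Continuous u) (hL : MemLAlpha α u) (x : Rn n) :
    Integrable fun z : Rn n => truncKernel α δ z * (u x - u (x + z)) := by
  simp_rw [mul_sub]
  exact ((integrable_truncKernel hα hδ).mul_const _).sub (integrable_truncKernel_mul hα hδ hu hL x)

lemma integrableOn_fracIntegrand (hα : 0 < α) {δ : ℝ} (hδ : 0 < δ) {u : Rn n → ℝ}
    (hu : Continuous u) (hL : MemLAlpha α u) (x : Rn n) :
    IntegrableOn (fracIntegrand α u x) {y : Rn n | δ ≤ ‖y - x‖} := by
  rw [← integrable_indicator_iff (measurableSet_le_norm_sub x δ), fracIntegrand_indicator]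
  exact (integrable_truncKernel_mul_sub hα hδ hu hL x).comp_sub_right x

lemma fracTrunc_eq (u : Rn n → ℝ) (x : Rn n) (δ : ℝ) :
    fracTrunc α u x δ =
      fracConst n α * ∫ z : Rn n, truncKernel α δ z * (u x - u (x + z)) := by
  rw [fracTrunc, ← integral_indicator (measurableSet_le_norm_sub x δ), fracIntegrand_indicator,
    integral_sub_right_eq_self (fun z => truncKernel α δ z * (u x - u (x + z))) x]

lemma integrable_truncKernel_mul_secondDiff (hα : 0 < α) {δ : ℝ} (hδ : 0 < δ) {u : Rn n → ℝ}
    (hu : Continuous u) (hL : MemLAlpha α u) (x : Rn n) :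
    Integrable fun z : Rn n => truncKernel α δ z * secondDiff u x z := by
  have h := integrable_truncKernel_mul_sub hα hδ hu hL x
  refine (h.add h.comp_neg).congr (.of_forall fun z => ?_)
  simp only [Pi.add_apply, truncKernel_neg, secondDiff, sub_eq_add_neg]
  ring

/-- The truncated kernel is even, so the integral may be averaged with its reflection. This performs
the cancellation of the principal value once and for all: the limit `δ → 0` becomes a case of
dominated convergence. -/
lemma fracTrunc_eq_secondDiff (hα : 0 < α) {δ : ℝ} (hδ : 0 < δ) {u : Rn n → ℝ}
    (hu : Continuous u) (hL : MemLAlpha α u) (x : Rn n) :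
    fracTrunc α u x δ =
      fracConst n α / 2 * ∫ z : Rn n, truncKernel α δ z * secondDiff u x z := by
  have h := integrable_truncKernel_mul_sub hα hδ hu hL x
  have key : ∫ z : Rn n, truncKernel α δ z * secondDiff u x z =
      (∫ z : Rn n, truncKernel α δ z * (u x - u (x + z))) +
        ∫ z : Rn n, truncKernel α δ z * (u x - u (x + z)) := by
    nth_rewrite 3 [← integral_neg_eq_self]
    rw [← integral_add h h.comp_neg]
    refine integral_congr_ae (.of_forall fun z => ?_)
    simp only [truncKernel_neg, secondDiff, sub_eq_add_neg]
    ring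
  rw [key, fracTrunc_eq]
  ring

lemma norm_fracKernel_mul_secondDiff_le {γ C : ℝ} {u : Rn n → ℝ} {x : Rn n}
    (hC : ∀ z : Rn n, ‖z‖ ≤ 1 → ‖secondDiff u x z‖ ≤ C * ‖z‖ ^ γ) (z : Rn n) :
    ‖fracKernel α z * secondDiff u x z‖ ≤
      (Metric.ball (0 : Rn n) 1).indicator
        (fun z => C * ((‖z‖ ^ ((n : ℝ) + α))⁻¹ * ‖z‖ ^ γ)) z +
        ‖truncKernel α 1 z * secondDiff u x z‖ := by
  rcases lt_or_ge ‖z‖ 1 with h | h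
  · rw [Set.indicator_of_mem (by simpa using h), truncKernel_of_lt h, zero_mul, norm_zero, add_zero]
    exact norm_near_le (hC z h.le)
  · rw [Set.indicator_of_notMem (by simpa using h), truncKernel_of_le h, zero_add]

lemma integrable_secondDiff_bound (hn : 0 < n) (hα : 0 < α) {γ : ℝ} (hγ : α < γ) {u : Rn n → ℝ}
    (hu : Continuous u) (hL : MemLAlpha α u) (C : ℝ) (x : Rn n) :
    Integrable fun z : Rn n => (Metric.ball (0 : Rn n) 1).indicator
        (fun z => C * ((‖z‖ ^ ((n : ℝ) + α))⁻¹ * ‖z‖ ^ γ)) z +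
        ‖truncKernel α 1 z * secondDiff u x z‖ := by
  refine Integrable.add ?_ (integrable_truncKernel_mul_secondDiff hα one_pos hu hL x).norm
  rw [integrable_indicator_iff Metric.isOpen_ball.measurableSet]
  exact (integrableOn_ball_norm_rpow_div hn (by linarith)).const_mul C

lemma integrable_fracKernel_mul_secondDiff (hn : 0 < n) (hα : 0 < α) {γ : ℝ} (hγ : α < γ)
    {u : Rn n → ℝ} (hu : Continuous u) (hL : MemLAlpha α u) (hu2 : LocSecondDiff γ u) (x : Rn n) :
    Integrable fun z : Rn n => fracKernel α z * secondDiff u x z := by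
  obtain ⟨C, -, hC⟩ := hu2 ‖x‖
  refine Integrable.mono' (integrable_secondDiff_bound hn hα hγ hu hL C x)
    (measurable_fracKernel.aestronglyMeasurable.mul ((continuous_secondDiff hu).comp
      (Continuous.prodMk_right x)).aestronglyMeasurable)
    (.of_forall (norm_fracKernel_mul_secondDiff_le (hC x · le_rfl)))

lemma tendsto_fracTrunc (hn : 0 < n) (hα : 0 < α) {γ : ℝ} (hγ : α < γ)
    {u : Rn n → ℝ} (hu : Continuous u) (hL : MemLAlpha α u) (hu2 : LocSecondDiff γ u) (x : Rn n) :
    Tendsto (fracTrunc α u x) (𝓝[>] 0)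
      (𝓝 (fracConst n α / 2 * ∫ z : Rn n, fracKernel α z * secondDiff u x z)) := by
  have h : Tendsto (fun δ => fracConst n α / 2 * ∫ z : Rn n, truncKernel α δ z * secondDiff u x z)
      (𝓝[>] 0) (𝓝 (fracConst n α / 2 * ∫ z : Rn n, fracKernel α z * secondDiff u x z)) := by
    refine Tendsto.const_mul _ ?_
    have hm : AEStronglyMeasurable (fun z => secondDiff u x z) (volume : Measure (Rn n)) :=
      ((continuous_secondDiff hu).comp (Continuous.prodMk_right x)).aestronglyMeasurable
    refine tendsto_integral_filter_of_dominated_convergence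
      (fun z => ‖fracKernel α z * secondDiff u x z‖)
      (.of_forall fun δ => (measurable_truncKernel δ).aestronglyMeasurable.mul hm)
      (.of_forall fun δ => .of_forall fun z => ?_)
      (integrable_fracKernel_mul_secondDiff hn hα hγ hu hL hu2 x).norm ?_
    · rw [norm_mul, norm_mul, Real.norm_of_nonneg (truncKernel_nonneg δ z),
        Real.norm_of_nonneg (fracKernel_nonneg z)]
      exact mul_le_mul_of_nonneg_right (truncKernel_le_fracKernel δ z) (norm_nonneg _)
    · have : NeZero n := ⟨hn.ne'⟩
      have : Nontrivial (Rn n) := inferInstance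
      filter_upwards [Measure.ae_ne volume (0 : Rn n)] with z hz
      refine tendsto_const_nhds.congr' ?_
      filter_upwards [Ioo_mem_nhdsGT (norm_pos_iff.2 hz)] with δ hδ
      rw [truncKernel_of_le hδ.2.le]
  refine h.congr' ?_
  filter_upwards [self_mem_nhdsWithin] with δ hδ
  rw [fracTrunc_eq_secondDiff hα hδ hu hL]

lemma fracLaplacian_eq (hn : 0 < n) (hα : 0 < α) {γ : ℝ} (hγ : α < γ)
    {u : Rn n → ℝ} (hu : Continuous u) (hL : MemLAlpha α u) (hu2 : LocSecondDiff γ u) (x : Rn n) :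
    fracLaplacian α u x = fracConst n α / 2 * ∫ z : Rn n, fracKernel α z * secondDiff u x z :=
  (tendsto_fracTrunc hn hα hγ hu hL hu2 x).limUnder_eq

lemma hasFracLaplacianAt (hn : 0 < n) (hα : 0 < α) {γ : ℝ} (hγ : α < γ)
    {u : Rn n → ℝ} (hu : Continuous u) (hL : MemLAlpha α u) (hu2 : LocSecondDiff γ u) (x : Rn n) :
    HasFracLaplacianAt α u x (fracLaplacian α u x) := by
  refine ⟨fun δ hδ => integrableOn_fracIntegrand hα hδ hu hL x, ?_⟩
  rw [fracLaplacian_eq hn hα hγ hu hL hu2]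
  exact tendsto_fracTrunc hn hα hγ hu hL hu2 x

lemma integral_abs_truncKernel_secondDiff_le (hα : 0 < α) {u : Rn n → ℝ}
    (hu : Continuous u) (hL : MemLAlpha α u) (x : Rn n) :
    ∫ z : Rn n, ‖truncKernel α 1 z * secondDiff u x z‖ ≤
      2 * (|u x| * ∫ z : Rn n, truncKernel α 1 z) +
      2 * ((1 + 1⁻¹) ^ ((n : ℝ) + α) * (2 * (1 + ‖x‖) ^ ((n : ℝ) + α)) *
        ∫ y : Rn n, |u y| / (1 + ‖y‖ ^ ((n : ℝ) + α))) := by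
  have i0 := integrable_truncKernel (n := n) hα one_pos
  have i1 := integrable_truncKernel_mul hα one_pos hu hL x
  have i2 := integrable_truncKernel_mul' hα one_pos hu hL x
  have e2 : ∫ z : Rn n, ‖truncKernel α 1 z * u (x - z)‖ =
      ∫ z : Rn n, ‖truncKernel α 1 z * u (x + z)‖ := by
    rw [← integral_neg_eq_self]
    simp [truncKernel_neg]
  have b := integral_abs_truncKernel_mul_le hα one_pos hu hL x
  calc _ ≤ ∫ z : Rn n, (2 * (|u x| * truncKernel α 1 z) + ‖truncKernel α 1 z * u (x + z)‖ +
          ‖truncKernel α 1 z * u (x - z)‖) := by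
        refine integral_mono (integrable_truncKernel_mul_secondDiff hα one_pos hu hL x).norm
          ((((i0.const_mul _).const_mul _).add i1.norm).add i2.norm) (fun z => ?_)
        have hk := truncKernel_nonneg (α := α) 1 z
        simp only [norm_mul, Real.norm_of_nonneg hk, Real.norm_eq_abs, secondDiff]
        have h1 := abs_add_le (u x - u (x + z)) (u x - u (x - z))
        have h2 := abs_sub (u x) (u (x + z))
        have h3 := abs_sub (u x) (u (x - z))
        nlinarith
    _ = 2 * (|u x| * ∫ z : Rn n, truncKernel α 1 z) +
        2 * ∫ z : Rn n, ‖truncKernel α 1 z * u (x + z)‖ := by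
        have i3 := (i0.const_mul |u x|).const_mul 2
        rw [integral_add (f := fun z => 2 * (|u x| * truncKernel α 1 z) +
          ‖truncKernel α 1 z * u (x + z)‖) (i3.add i1.norm) i2.norm,
          integral_add i3 i1.norm, e2, integral_const_mul,
          integral_const_mul]
        ring
    _ ≤ _ := by linarith

/-- The truncated integrals are locally bounded, uniformly in the truncation. -/
lemma exists_bound_fracTrunc (hn : 0 < n) (hα : 0 < α) {γ : ℝ} (hγ : α < γ)
    {u : Rn n → ℝ} (hu : Continuous u) (hL : MemLAlpha α u) (hu2 : LocSecondDiff γ u) (R : ℝ) :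
    ∃ B : ℝ, ∀ x : Rn n, ‖x‖ ≤ R → ∀ δ : ℝ, 0 < δ → |fracTrunc α u x δ| ≤ B := by
  obtain ⟨C, -, hC⟩ := hu2 R
  obtain ⟨U, hU⟩ := (isCompact_closedBall (0 : Rn n) R).exists_bound_of_continuousOn
    hu.continuousOn
  refine ⟨|fracConst n α / 2| * ((∫ z in Metric.ball (0 : Rn n) 1,
      C * ((‖z‖ ^ ((n : ℝ) + α))⁻¹ * ‖z‖ ^ γ)) +
    (2 * (U * ∫ z : Rn n, truncKernel α 1 z) +
      2 * ((1 + 1⁻¹) ^ ((n : ℝ) + α) * (2 * (1 + R) ^ ((n : ℝ) + α)) *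
        ∫ y : Rn n, |u y| / (1 + ‖y‖ ^ ((n : ℝ) + α))))), fun x hx δ hδ => ?_⟩
  rw [fracTrunc_eq_secondDiff hα hδ hu hL, abs_mul]
  refine mul_le_mul_of_nonneg_left ?_ (abs_nonneg _)
  have hB := integrable_secondDiff_bound hn hα hγ hu hL C x
  refine (norm_integral_le_of_norm_le (f := fun z => truncKernel α δ z * secondDiff u x z) hB
    (.of_forall fun z => ?_)).trans ?_
  · refine le_trans ?_ (norm_fracKernel_mul_secondDiff_le (hC x · hx) z)
    rw [norm_mul, norm_mul, Real.norm_of_nonneg (truncKernel_nonneg δ z),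
        Real.norm_of_nonneg (fracKernel_nonneg z)]
    exact mul_le_mul_of_nonneg_right (truncKernel_le_fracKernel δ z) (norm_nonneg _)
  · have hi : Integrable ((Metric.ball (0 : Rn n) 1).indicator
        (fun z : Rn n => C * ((‖z‖ ^ ((n : ℝ) + α))⁻¹ * ‖z‖ ^ γ))) := by
      rw [integrable_indicator_iff Metric.isOpen_ball.measurableSet]
      exact (integrableOn_ball_norm_rpow_div hn (by linarith)).const_mul C
    rw [integral_add hi (integrable_truncKernel_mul_secondDiff hα one_pos hu hL x).norm,
      integral_indicator Metric.isOpen_ball.measurableSet]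
    have hI : 0 ≤ ∫ z : Rn n, truncKernel α 1 z := integral_nonneg (truncKernel_nonneg 1)
    have hJ : 0 ≤ ∫ y : Rn n, |u y| / (1 + ‖y‖ ^ ((n : ℝ) + α)) :=
      integral_nonneg fun y => by positivity
    have hUx : |u x| ≤ U := hU x (by simpa using hx)
    refine add_le_add le_rfl ((integral_abs_truncKernel_secondDiff_le hα hu hL x).trans ?_)
    have hR : (1 + ‖x‖) ^ ((n : ℝ) + α) ≤ (1 + R) ^ ((n : ℝ) + α) :=
      Real.rpow_le_rpow (by positivity) (by linarith) (by positivity)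
    gcongr

end FracLaplacian

/-! ### Regularity of the fractional Laplacian -/

section Regularity

variable {n : ℕ} {α : ℝ}

lemma MemLAlpha.mono {u v : Rn n → ℝ} (hu : MemLAlpha α u) (hv : Continuous v)
    (h : ∀ x, |v x| ≤ |u x|) : MemLAlpha α v := by
  have hm : Measurable fun x : Rn n => 1 + ‖x‖ ^ ((n : ℝ) + α) := by fun_prop
  refine Integrable.mono' hu
    (hv.abs.measurable.div hm).aestronglyMeasurable
    (.of_forall fun x => ?_)
  rw [Real.norm_of_nonneg (by positivity)]
  exact div_le_div_of_nonneg_right (h x) (by positivity)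

/-- The inversion `y ↦ y / |y|²`. -/
def unitInversion (y : Rn n) : Rn n := (‖y‖ ^ 2)⁻¹ • y

lemma norm_unitInversion (y : Rn n) : ‖unitInversion y‖ = ‖y‖⁻¹ := by
  rw [unitInversion, norm_smul, Real.norm_of_nonneg (by positivity)]
  rcases eq_or_ne ‖y‖ 0 with h | h
  · simp [h]
  · field_simp

lemma unitInversion_involutive : Function.Involutive (unitInversion : Rn n → Rn n) := by
  intro y
  rw [unitInversion, norm_unitInversion, unitInversion, smul_smul]
  rcases eq_or_ne y 0 with h | h
  · simp [h]
  · have : ‖y‖ ≠ 0 := norm_ne_zero_iff.2 h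
    rw [inv_pow, inv_inv, mul_inv_cancel₀ (by positivity), one_smul]

lemma measurable_unitInversion : Measurable (unitInversion : Rn n → Rn n) := by
  unfold unitInversion; fun_prop

/-- The inversion as a measurable equivalence. -/
def unitInversionEquiv (n : ℕ) : Rn n ≃ᵐ Rn n :=
  MeasurableEquiv.ofInvolutive unitInversion unitInversion_involutive measurable_unitInversion

/-- The kernel `|x + y|^{-s}` in inverted coordinates, up to a power of `|y|`. -/
def invertedKernel (s : ℝ) (x z : Rn n) : ℝ :=
  (1 + 2 * inner ℝ x z + ‖x‖ ^ 2 * ‖z‖ ^ 2) ^ (-(s / 2))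

/-- By Cauchy–Schwarz the expression is at least `(1 - |x||z|)²`. Positivity is what makes the real
power smooth. -/
lemma inverted_base_pos {x z : Rn n} (h : ‖x‖ * ‖z‖ ≤ 1 / 2) :
    0 < 1 + 2 * inner ℝ x z + ‖x‖ ^ 2 * ‖z‖ ^ 2 := by
  have := neg_le_of_abs_le (abs_real_inner_le_norm x z)
  nlinarith [sq_nonneg (1 - ‖x‖ * ‖z‖)]

lemma contDiffAt_invertedKernel {k : ℕ∞} (s : ℝ) {x z : Rn n} (h : ‖x‖ * ‖z‖ ≤ 1 / 2) :
    ContDiffAt ℝ k (fun p : Rn n × Rn n => invertedKernel s p.1 p.2) (x, z) := by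
  refine ContDiffAt.rpow_const_of_ne ?_ (inverted_base_pos h).ne'
  have h1 : ContDiff ℝ k fun p : Rn n × Rn n =>
      1 + 2 * inner ℝ p.1 p.2 + ‖p.1‖ ^ 2 * ‖p.2‖ ^ 2 :=
    (contDiff_const.add (contDiff_const.mul (contDiff_fst.inner ℝ contDiff_snd))).add
      ((contDiff_fst.norm_sq ℝ).mul (contDiff_snd.norm_sq ℝ))
  exact h1.contDiffAt

lemma fracKernel_eq_inverted {x y : Rn n} (hy : y ≠ 0) :
    fracKernel α (x - y) =
      fracKernel α y * invertedKernel ((n : ℝ) + α) x (-unitInversion y) := by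
  have hy0 : 0 < ‖y‖ := norm_pos_iff.2 hy
  have e : ‖x - y‖ ^ 2 = ‖y‖ ^ 2 *
      (1 + 2 * inner ℝ x (-unitInversion y) + ‖x‖ ^ 2 * ‖-unitInversion y‖ ^ 2) := by
    rw [norm_neg, norm_unitInversion, inner_neg_right, unitInversion, inner_smul_right,
      norm_sub_sq_real]
    field_simp
    ring
  have pw : ∀ (w : Rn n), fracKernel α w = (‖w‖ ^ 2) ^ (-(((n : ℝ) + α) / 2)) := by
    intro w
    rw [fracKernel, ← Real.rpow_natCast, ← Real.rpow_mul (norm_nonneg w),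
      ← Real.rpow_neg (norm_nonneg w)]
    congr 1
    push_cast
    ring
  rw [pw, pw, invertedKernel, e, Real.mul_rpow (by positivity)]
  by_contra! hneg
  have : ‖x - y‖ ^ 2 < 0 := by rw [e]; exact mul_neg_of_pos_of_neg (by positivity) hneg
  exact absurd this (not_lt.2 (by positivity))

open scoped ContDiff Convolution in
/-- The convolution of the truncated kernel with a function vanishing near a large ball is smooth
on a smaller ball. -/
lemma contDiffOn_far (hα : 0 < α) {k : ℕ∞} {u : Rn n → ℝ} (hu : Continuous u)
    (hL : MemLAlpha α u) {ρ : ℝ} (hρ : 1 ≤ ρ) (hu0 : ∀ y, ‖y‖ ≤ 4 * ρ → u y = 0) :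
    ContDiffOn ℝ k (fun x => ∫ z : Rn n, truncKernel α 1 z * u (x - z)) (Metric.ball 0 ρ) := by
  have hR : 0 < (4 * ρ)⁻¹ := by positivity
  -- Inversion sends the region `|y| ≥ 4ρ` into the compact ball of radius `1/(4ρ)`, where `ψ = 1`.
  -- On the support of `ψ`, of radius `1/(2ρ)`, one has `|x||z| ≤ 1/2` for `|x| < ρ`, so the
  -- inverted kernel is smooth there. With `μ` the push-forward of Lebesgue measure, no Jacobian
  -- appears.
  let ψ : ContDiffBump (0 : Rn n) := ⟨(4 * ρ)⁻¹, 2 * (4 * ρ)⁻¹, hR, by linarith⟩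
  let g : Rn n → Rn n → ℝ := fun x z => ψ z * invertedKernel ((n : ℝ) + α) x z
  let f : Rn n → ℝ := fun t => fracKernel α (unitInversion t) * u (unitInversion t)
  let μ : Measure (Rn n) := Measure.map (unitInversionEquiv n) volume
  have hg0 : ∀ p x : Rn n, p ∈ Metric.ball 0 ρ → x ∉ Metric.closedBall 0 (2 * (4 * ρ)⁻¹) →
      g p x = 0 := by
    intro p x _ hx
    have : ψ x = 0 := ψ.zero_of_le_dist (by
      rw [Metric.mem_closedBall, not_le] at hx; exact hx.le)
    simp [g, this]
  have hg : ContDiffOn ℝ k (Function.uncurry g) (Metric.ball 0 ρ ×ˢ Set.univ) := by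
    rintro ⟨x, z⟩ ⟨hx, -⟩
    refine ContDiffAt.contDiffWithinAt ?_
    by_cases hz : z ∈ Metric.closedBall (0 : Rn n) (2 * (4 * ρ)⁻¹)
    · rw [mem_closedBall_zero_iff] at hz
      rw [mem_ball_zero_iff] at hx
      have hxz : ‖x‖ * ‖z‖ ≤ 1 / 2 := by
        calc ‖x‖ * ‖z‖ ≤ ρ * (2 * (4 * ρ)⁻¹) := by gcongr
          _ = 1 / 2 := by field_simp; norm_num
      have h1 : ContDiff ℝ k fun p : Rn n × Rn n => ψ p.2 := ψ.contDiff.comp contDiff_snd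
      exact h1.contDiffAt.mul (contDiffAt_invertedKernel _ hxz)
    · refine (contDiffAt_const (c := (0 : ℝ))).congr_of_eventuallyEq ?_
      have hU : IsOpen (Metric.ball (0 : Rn n) ρ ×ˢ
          (Metric.closedBall (0 : Rn n) (2 * (4 * ρ)⁻¹))ᶜ) :=
        Metric.isOpen_ball.prod Metric.isClosed_closedBall.isOpen_compl
      filter_upwards [hU.mem_nhds ⟨hx, hz⟩] with p hp
      exact hg0 _ _ hp.1 hp.2
  have hf : Integrable f μ := by
    rw [integrable_map_equiv]
    refine (integrable_truncKernel_mul hα one_pos hu hL 0).congr (.of_forall fun y => ?_)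
    change _ = fracKernel α (unitInversion (unitInversion y)) * u (unitInversion (unitInversion y))
    rw [unitInversion_involutive]
    simp only [zero_add]
    rcases le_or_gt 1 ‖y‖ with h | h
    · rw [truncKernel_of_le h]
    · rw [hu0 y (by linarith), mul_zero, mul_zero]
  -- The convolution is evaluated at the fixed point `0`, and `x` enters only as the parameter of
  -- `g`. This is why the kernel is taken at minus the inverted point.
  have key := contDiffOn_convolution_right_with_param_comp (ContinuousLinearMap.mul ℝ ℝ)
    (contDiffOn_const (c := (0 : Rn n))) Metric.isOpen_ball (isCompact_closedBall _ _) hg0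
    hf.locallyIntegrable hg
  refine key.congr fun x hx => ?_
  rw [convolution_def, integral_map_equiv, ← integral_sub_left_eq_self _ volume x]
  refine integral_congr_ae (.of_forall fun y => ?_)
  change truncKernel α 1 (x - y) * u (x - (x - y)) =
    (fracKernel α (unitInversion (unitInversion y)) * u (unitInversion (unitInversion y))) *
      (ψ (0 - unitInversion y) * invertedKernel ((n : ℝ) + α) x (0 - unitInversion y))
  rw [unitInversion_involutive, sub_sub_cancel, zero_sub]
  rcases le_or_gt ‖y‖ (4 * ρ) with h | h
  · rw [hu0 y h]; ring
  · have hψ : ψ (-unitInversion y) = 1 := by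
      refine ψ.one_of_mem_closedBall ?_
      rw [mem_closedBall_zero_iff, norm_neg, norm_unitInversion]
      exact inv_anti₀ (by positivity) h.le
    have hx' : ‖x‖ < ρ := by simpa using hx
    -- Here `|x - y| ≥ 3ρ ≥ 1`, so the truncation, and with it the jump of the kernel at radius `1`,
    -- is never felt.
    have hxy : 1 ≤ ‖x - y‖ := by
      have := norm_sub_norm_le y x
      rw [norm_sub_rev] at this
      linarith
    have hy : y ≠ 0 := by
      rintro rfl
      rw [norm_zero] at h
      linarith
    rw [hψ, truncKernel_of_le hxy, fracKernel_eq_inverted hy]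
    ring

open scoped ContDiff Convolution in
-- The truncated kernel jumps at `|z| = 1`, while the derivatives of `u` are not controlled at
-- infinity. A cutoff `χ` around `x₀` separates the two problems: derivatives fall on `χ u` in the
-- near piece and on the kernel in the far piece.
lemma contDiff_truncKernel_conv (hα : 0 < α) {k : ℕ∞} {u : Rn n → ℝ} (hu : ContDiff ℝ k u)
    (hL : MemLAlpha α u) :
    ContDiff ℝ k (fun x => ∫ z : Rn n, truncKernel α 1 z * u (x - z)) := by
  rw [contDiff_iff_contDiffAt]
  intro x₀
  have hρ : 1 ≤ ‖x₀‖ + 1 := by linarith [norm_nonneg x₀]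
  let χ : ContDiffBump (0 : Rn n) :=
    ⟨4 * (‖x₀‖ + 1), 4 * (‖x₀‖ + 1) + 1, by positivity, by linarith⟩
  have hχ1 : ∀ y, 0 ≤ χ y ∧ χ y ≤ 1 := fun y => ⟨χ.nonneg, χ.le_one⟩
  have hχc : Continuous fun y => χ y := χ.continuous
  have c1 : Continuous fun y => χ y * u y := hχc.mul hu.continuous
  have c2 : Continuous fun y => (1 - χ y) * u y := (continuous_const.sub hχc).mul hu.continuous
  have m1 : MemLAlpha α fun y => χ y * u y := hL.mono c1 fun y => by
    rw [abs_mul, abs_of_nonneg (hχ1 y).1]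
    exact mul_le_of_le_one_left (abs_nonneg _) (hχ1 y).2
  have m2 : MemLAlpha α fun y => (1 - χ y) * u y := hL.mono c2 fun y => by
    rw [abs_mul, abs_of_nonneg (by linarith [(hχ1 y).2])]
    exact mul_le_of_le_one_left (abs_nonneg _) (by linarith [(hχ1 y).1])
  have e : (fun x => ∫ z : Rn n, truncKernel α 1 z * u (x - z)) =
      fun x => (∫ z : Rn n, truncKernel α 1 z * (χ (x - z) * u (x - z))) +
        ∫ z : Rn n, truncKernel α 1 z * ((1 - χ (x - z)) * u (x - z)) := by
    ext x
    rw [← integral_add (integrable_truncKernel_mul' hα one_pos c1 m1 x)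
      (integrable_truncKernel_mul' hα one_pos c2 m2 x)]
    congr 1
    ext z
    ring
  rw [e]
  have d1 : ContDiff ℝ k fun x => ∫ z : Rn n, truncKernel α 1 z * (χ (x - z) * u (x - z)) :=
    HasCompactSupport.contDiff_convolution_right (ContinuousLinearMap.mul ℝ ℝ)
      (HasCompactSupport.mul_right χ.hasCompactSupport)
      (integrable_truncKernel hα one_pos).locallyIntegrable (χ.contDiff.mul hu)
  have d2 := contDiffOn_far (k := k) hα c2 m2 hρ (fun y hy => by
    rw [χ.one_of_mem_closedBall (by simpa using hy), sub_self, zero_mul])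
  exact d1.contDiffAt.add (d2.contDiffAt (Metric.isOpen_ball.mem_nhds (by simp)))

lemma integral_fracKernel_secondDiff (hn : 0 < n) (hα : 0 < α) {γ : ℝ} (hγ : α < γ)
    {u : Rn n → ℝ} (hu : Continuous u) (hL : MemLAlpha α u) (hu2 : LocSecondDiff γ u) (x : Rn n) :
    ∫ z : Rn n, fracKernel α z * secondDiff u x z = nearPart ((n : ℝ) + α) u x +
      2 * ((∫ z : Rn n, truncKernel α 1 z) * u x - ∫ z : Rn n, truncKernel α 1 z * u (x - z)) := by
  have h1 := integrable_truncKernel_mul_secondDiff hα one_pos hu hL x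
  have hnear : Integrable ((Metric.ball (0 : Rn n) 1).indicator
      fun z => fracKernel α z * secondDiff u x z) := by
    rw [integrable_indicator_iff Metric.isOpen_ball.measurableSet]
    exact (integrable_fracKernel_mul_secondDiff hn hα hγ hu hL hu2 x).integrableOn
  have e1 : ∫ z : Rn n, fracKernel α z * secondDiff u x z = nearPart ((n : ℝ) + α) u x +
      ∫ z : Rn n, truncKernel α 1 z * secondDiff u x z := by
    have : nearPart ((n : ℝ) + α) u x = ∫ z, (Metric.ball (0 : Rn n) 1).indicator
        (fun z => fracKernel α z * secondDiff u x z) z := by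
      rw [integral_indicator Metric.isOpen_ball.measurableSet]; rfl
    rw [this, ← integral_add hnear h1]
    refine integral_congr_ae (.of_forall fun z => ?_)
    rcases lt_or_ge ‖z‖ 1 with h | h
    · simp [h, truncKernel_of_lt h]
    · simp [not_lt.2 h, truncKernel_of_le h]
  have i0 := (integrable_truncKernel (n := n) hα one_pos).mul_const (u x)
  have i1 := integrable_truncKernel_mul' hα one_pos hu hL x
  have i2 : Integrable fun z : Rn n => truncKernel α 1 z * u x - truncKernel α 1 z * u (x - z) :=
    i0.sub i1
  have e2 : ∫ z : Rn n, truncKernel α 1 z * secondDiff u x z =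
      2 * ∫ z : Rn n, (truncKernel α 1 z * u x - truncKernel α 1 z * u (x - z)) := by
    have e3 : ∀ z, truncKernel α 1 z * secondDiff u x z =
        (truncKernel α 1 z * u x - truncKernel α 1 z * u (x - z)) +
        (truncKernel α 1 (-z) * u x - truncKernel α 1 (-z) * u (x - -z)) := by
      intro z
      simp only [truncKernel_neg, secondDiff, sub_eq_add_neg, neg_neg]
      ring
    simp_rw [e3]
    rw [integral_add i2 i2.comp_neg, integral_neg_eq_self
      (fun z => truncKernel α 1 z * u x - truncKernel α 1 z * u (x - z))]
    ring
  rw [e1, e2, integral_sub i0 i1, integral_mul_const]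

lemma LocHolder.locSecondDiff_of_add {k a : ℕ} (ha : a ≤ 1) {β : ℝ} (hβ : 0 < β) (hβ1 : β ≤ 1)
    {u : Rn n → ℝ} (hu : LocHolder (k + a) β u) : LocSecondDiff (a + β) u :=
  (hu.of_add hβ1).locSecondDiff ha hβ

lemma contDiff_fracLaplacian (hn : 0 < n) (hα : 0 < α) {a : ℕ} (ha : a ≤ 1) {β : ℝ} (hβ : 0 < β)
    (hβ1 : β ≤ 1) (h : α < a + β) {k : ℕ} {u : Rn n → ℝ} (hu : LocHolder (k + a) β u)
    (hL : MemLAlpha α u) : ContDiff ℝ (k : ℕ) (fracLaplacian α u) := by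
  have hk : ContDiff ℝ (k : ℕ) u := hu.1.of_le (by exact_mod_cast Nat.le_add_right k a)
  have h2 := hu.locSecondDiff_of_add ha hβ hβ1
  have e : fracLaplacian α u = fun x => fracConst n α / 2 * (nearPart ((n : ℝ) + α) u x +
      2 * ((∫ z : Rn n, truncKernel α 1 z) * u x -
        ∫ z : Rn n, truncKernel α 1 z * u (x - z))) := by
    ext x
    rw [fracLaplacian_eq hn hα h hu.1.continuous hL h2,
      integral_fracKernel_secondDiff hn hα h hu.1.continuous hL h2]
  rw [e]
  have d1 := contDiff_nearPart (s := (n : ℝ) + α) hn ha hβ hβ1 (by linarith) k hu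
  have d2 := contDiff_truncKernel_conv (k := (k : ℕ∞)) hα hk hL
  exact contDiff_const.mul (d1.add (contDiff_const.mul ((contDiff_const.mul hk).sub d2)))

end Regularity

/-! ### Averages of the fractional Laplacian on large balls -/

section Averages

variable {n : ℕ} {α : ℝ}

lemma memLAlpha_of_hasCompactSupport (hα : 0 < α) {φ : Rn n → ℝ} (hφ : Continuous φ)
    (hs : HasCompactSupport φ) : MemLAlpha α φ := by
  refine Continuous.integrable_of_hasCompactSupport ?_ ?_
  · refine hφ.abs.div₀ (continuous_const.add
      (continuous_norm.rpow_const fun x => Or.inr (by positivity))) (fun x => by positivity)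
  · refine hs.mono fun x hx => ?_
    rw [Function.mem_support] at hx ⊢
    contrapose! hx
    simp [hx]

lemma locHolder_one_of_contDiff {k : ℕ} {φ : Rn n → ℝ} (hφ : ContDiff ℝ ((k + 1 : ℕ)) φ) :
    LocHolder k 1 φ := by
  refine ⟨hφ.of_le (by exact_mod_cast Nat.le_succ k), fun K hK => ?_⟩
  obtain ⟨R, hR⟩ := hK.isBounded.exists_norm_le
  obtain ⟨C, -, hC⟩ := exists_lipschitz_of_contDiff (g := iteratedFDeriv ℝ k φ)
    (hφ.iteratedFDeriv_right (by exact_mod_cast (add_comm 1 k).le)) R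
  exact ⟨C, fun x hx y hy => by simpa using hC x y (hR x hx) (hR y hy)⟩

lemma stronglyMeasurable_fracTrunc {u : Rn n → ℝ} (hu : Continuous u) (δ : ℝ) :
    StronglyMeasurable fun x => fracTrunc α u x δ := by
  simp_rw [fracTrunc_eq]
  refine StronglyMeasurable.const_mul ?_ _
  refine StronglyMeasurable.integral_prod_right' (f := fun p : Rn n × Rn n =>
    truncKernel α δ p.2 * (u p.1 - u (p.1 + p.2))) ?_
  refine Measurable.stronglyMeasurable ?_
  exact ((measurable_truncKernel δ).comp measurable_snd).mul
    (by fun_prop : Continuous fun p : Rn n × Rn n => u p.1 - u (p.1 + p.2)).measurable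

lemma fracTrunc_eq_sub (hα : 0 < α) {δ : ℝ} (hδ : 0 < δ) {u : Rn n → ℝ}
    (hu : Continuous u) (hL : MemLAlpha α u) (x : Rn n) :
    fracTrunc α u x δ = fracConst n α * ((∫ z : Rn n, truncKernel α δ z) * u x -
      ∫ z : Rn n, truncKernel α δ z * u (x + z)) := by
  rw [fracTrunc_eq, ← integral_mul_const, ← integral_sub
    ((integrable_truncKernel hα hδ).mul_const _) (integrable_truncKernel_mul hα hδ hu hL x)]
  simp_rw [mul_sub]

lemma integrable_prod_truncKernel (hα : 0 < α) {δ : ℝ} (hδ : 0 < δ) {u φ : Rn n → ℝ}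
    (hu : Continuous u) (hL : MemLAlpha α u) (hφ : Continuous φ) (hs : HasCompactSupport φ) :
    Integrable (Function.uncurry fun x y : Rn n => φ x * (truncKernel α δ (y - x) * u y))
      (volume.prod volume) := by
  have hm : Measurable (Function.uncurry fun x y : Rn n =>
      φ x * (truncKernel α δ (y - x) * u y)) :=
    (hφ.measurable.comp measurable_fst).mul
      (((measurable_truncKernel δ).comp (measurable_snd.sub measurable_fst)).mul
        (hu.measurable.comp measurable_snd))
  have hy : ∀ x : Rn n, Integrable fun y : Rn n => truncKernel α δ (y - x) * u y := by
    intro x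
    simpa using (integrable_truncKernel_mul hα hδ hu hL x).comp_sub_right x
  rw [integrable_prod_iff hm.aestronglyMeasurable]
  have hy' : ∀ x : Rn n, Integrable fun y : Rn n => φ x * (truncKernel α δ (y - x) * u y) :=
    fun x => (hy x).const_mul (φ x)
  refine ⟨.of_forall hy', ?_⟩
  let c : Rn n → ℝ := fun x => |φ x| * ((1 + δ⁻¹) ^ ((n : ℝ) + α) *
    (2 * (1 + ‖x‖) ^ ((n : ℝ) + α)) * ∫ y : Rn n, |u y| / (1 + ‖y‖ ^ ((n : ℝ) + α)))
  have hc : Integrable c := by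
    refine Continuous.integrable_of_hasCompactSupport ?_ ?_
    · refine hφ.abs.mul ((continuous_const.mul (continuous_const.mul
        ((continuous_const.add continuous_norm).rpow_const fun x => Or.inr (by positivity)))).mul
          continuous_const)
    · exact HasCompactSupport.mul_right (hs.comp_left (g := fun t : ℝ => |t|) abs_zero)
  refine Integrable.mono' hc hm.norm.stronglyMeasurable.integral_prod_right'.aestronglyMeasurable
    (.of_forall fun x => ?_)
  rw [Real.norm_of_nonneg (integral_nonneg fun y => norm_nonneg _)]
  have e : ∫ y : Rn n, ‖Function.uncurry (fun x y : Rn n =>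
      φ x * (truncKernel α δ (y - x) * u y)) (x, y)‖ =
      |φ x| * ∫ z : Rn n, ‖truncKernel α δ z * u (x + z)‖ := by
    rw [← integral_sub_right_eq_self (fun z => ‖truncKernel α δ z * u (x + z)‖) x,
      ← integral_const_mul]
    refine integral_congr_ae (.of_forall fun y => ?_)
    simp [Function.uncurry]
  rw [e]
  exact mul_le_mul_of_nonneg_left (integral_abs_truncKernel_mul_le hα hδ hu hL x) (abs_nonneg _)

/-- The truncated fractional Laplacian is symmetric. -/
lemma integral_fracTrunc_mul (hα : 0 < α) {δ : ℝ} (hδ : 0 < δ) {u φ : Rn n → ℝ}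
    (hu : Continuous u) (hL : MemLAlpha α u) (hφ : Continuous φ) (hs : HasCompactSupport φ) :
    ∫ x, fracTrunc α u x δ * φ x = ∫ x, u x * fracTrunc α φ x δ := by
  have hI := integrable_prod_truncKernel hα hδ hu hL hφ hs
  have hφL := memLAlpha_of_hasCompactSupport hα hφ hs
  have huφ : Integrable fun x => u x * φ x :=
    (hu.mul hφ).integrable_of_hasCompactSupport hs.mul_left
  have hA : ∀ x, ∫ y, φ x * (truncKernel α δ (y - x) * u y) =
      φ x * ∫ z, truncKernel α δ z * u (x + z) := by
    intro x
    rw [← integral_sub_right_eq_self (fun z => truncKernel α δ z * u (x + z)) x,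
      ← integral_const_mul]
    simp
  have hB : ∀ y, ∫ x, φ x * (truncKernel α δ (y - x) * u y) =
      u y * ∫ z, truncKernel α δ z * φ (y + z) := by
    intro y
    rw [← integral_sub_right_eq_self (fun z => truncKernel α δ z * φ (y + z)) y,
      ← integral_const_mul]
    refine integral_congr_ae (.of_forall fun x => ?_)
    change φ x * (truncKernel α δ (y - x) * u y) =
      u y * (truncKernel α δ (x - y) * φ (y + (x - y)))
    rw [← truncKernel_neg, neg_sub, add_sub_cancel]
    ring
  have iA : Integrable fun x => φ x * ∫ z, truncKernel α δ z * u (x + z) := by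
    simpa [hA] using hI.integral_prod_left
  have iB : Integrable fun y => u y * ∫ z, truncKernel α δ z * φ (y + z) := by
    simpa [hB] using hI.integral_prod_right
  have swap := integral_integral_swap hI
  simp_rw [hA, hB] at swap
  simp_rw [fracTrunc_eq_sub hα hδ hu hL, fracTrunc_eq_sub hα hδ hφ hφL]
  have e1 : ∀ x, fracConst n α * ((∫ z : Rn n, truncKernel α δ z) * u x -
      ∫ z : Rn n, truncKernel α δ z * u (x + z)) * φ x =
      fracConst n α * ((∫ z : Rn n, truncKernel α δ z) * (u x * φ x) -
        φ x * ∫ z : Rn n, truncKernel α δ z * u (x + z)) := fun x => by ring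
  have e2 : ∀ x, u x * (fracConst n α * ((∫ z : Rn n, truncKernel α δ z) * φ x -
      ∫ z : Rn n, truncKernel α δ z * φ (x + z))) =
      fracConst n α * ((∫ z : Rn n, truncKernel α δ z) * (u x * φ x) -
        u x * ∫ z : Rn n, truncKernel α δ z * φ (x + z)) := fun x => by ring
  simp_rw [e1, e2]
  rw [integral_const_mul, integral_const_mul, integral_sub (huφ.const_mul _) iA,
    integral_sub (huφ.const_mul _) iB, swap]

/-- The fractional Laplacian of a test function is `O(|x|^{-n-α})`, uniformly in the
truncation. -/
lemma exists_decay_fracTrunc (hn : 0 < n) (hα : 0 < α) (hα2 : α < 2) {φ : Rn n → ℝ}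
    (hφ : ContDiff ℝ 2 φ) (hs : HasCompactSupport φ) :
    ∃ A : ℝ, ∀ x : Rn n, ∀ δ : ℝ, 0 < δ →
      |fracTrunc α φ x δ| ≤ A * (1 + ‖x‖) ^ (-((n : ℝ) + α)) := by
  have hL := memLAlpha_of_hasCompactSupport hα hφ.continuous hs
  -- Second differences of a `C²` function have order `2`, which exceeds `α`.
  have h2 : LocSecondDiff (1 + 1) φ :=
    (locHolder_one_of_contDiff (k := 1) (by exact_mod_cast hφ)).locSecondDiff_one one_pos
  obtain ⟨ρ, hρ0, hρ⟩ : ∃ ρ : ℝ, 0 < ρ ∧ ∀ x, ρ < ‖x‖ → φ x = 0 := by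
    obtain ⟨ρ, hρ⟩ := hs.isCompact.isBounded.exists_norm_le
    refine ⟨max ρ 1, by positivity, fun x hx => image_eq_zero_of_notMem_tsupport fun hx' => ?_⟩
    exact absurd (hρ x hx') (not_le.2 ((le_max_left _ _).trans_lt hx))
  obtain ⟨B, hB⟩ := exists_bound_fracTrunc hn hα (by linarith) hφ.continuous hL h2 (2 * ρ)
  have hB0 : 0 ≤ B := (abs_nonneg _).trans (hB 0 (by rw [norm_zero]; positivity) 1 one_pos)
  let D : ℝ := |fracConst n α| * (2 ^ ((n : ℝ) + α) * (1 + (2 * ρ)⁻¹) ^ ((n : ℝ) + α) *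
    ∫ y, |φ y|)
  have hD : 0 ≤ D := by
    have : 0 ≤ ∫ y, |φ y| := integral_nonneg fun y => abs_nonneg _
    positivity
  refine ⟨B * (1 + 2 * ρ) ^ ((n : ℝ) + α) + D, fun x δ hδ => ?_⟩
  rcases le_or_gt ‖x‖ (2 * ρ) with h | h
  · have h1 : 1 ≤ (1 + 2 * ρ) ^ ((n : ℝ) + α) * (1 + ‖x‖) ^ (-((n : ℝ) + α)) := by
      rw [Real.rpow_neg (by positivity), ← div_eq_mul_inv, one_le_div (by positivity)]
      exact Real.rpow_le_rpow (by positivity) (by linarith) (by positivity)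
    calc _ ≤ B * 1 := by rw [mul_one]; exact hB x h δ hδ
      _ ≤ B * ((1 + 2 * ρ) ^ ((n : ℝ) + α) * (1 + ‖x‖) ^ (-((n : ℝ) + α))) := by gcongr
      _ ≤ _ := by
        rw [← mul_assoc]
        gcongr
        linarith
  -- Far from the support only `z` with `|x + z| ≤ ρ` contribute. These satisfy `|z| ≥ |x|/2`, so
  -- the kernel is at most `2^{n+α} |x|^{-n-α}`.
  · have hx0 : φ x = 0 := hρ x (by linarith)
    have hφi : Integrable fun z => |φ (x + z)| :=
      (hφ.continuous.integrable_of_hasCompactSupport hs).abs.comp_add_left x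
    have hb : ‖∫ z : Rn n, truncKernel α δ z * (φ x - φ (x + z))‖ ≤
        ∫ z : Rn n, (2 ^ ((n : ℝ) + α) * (‖x‖ ^ ((n : ℝ) + α))⁻¹) * |φ (x + z)| := by
      refine norm_integral_le_of_norm_le (hφi.const_mul _) (.of_forall fun z => ?_)
      rw [hx0, zero_sub, norm_mul, norm_neg, Real.norm_of_nonneg (truncKernel_nonneg δ z),
        Real.norm_eq_abs]
      rcases le_or_gt ‖x + z‖ ρ with hz | hz
      · refine mul_le_mul_of_nonneg_right ((truncKernel_le_fracKernel δ z).trans ?_) (abs_nonneg _)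
        have hz2 : ‖x‖ / 2 ≤ ‖z‖ := by
          have := norm_sub_le (x + z) z
          rw [add_sub_cancel_right] at this
          linarith
        have hxp : 0 < ‖x‖ := by linarith
        rw [fracKernel, ← div_eq_mul_inv, ← inv_div, ← Real.div_rpow hxp.le zero_le_two]
        exact inv_anti₀ (by positivity) (Real.rpow_le_rpow (by positivity) hz2 (by positivity))
      · rw [hρ _ hz]; simp
    rw [integral_const_mul, integral_add_left_eq_self (fun y => |φ y|) x] at hb
    have hw := norm_rpow_inv_le_one_add (s := (n : ℝ) + α) (by positivity : 0 < 2 * ρ)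
      (by positivity) h.le
    have hI : 0 ≤ ∫ y, |φ y| := integral_nonneg fun y => abs_nonneg _
    rw [fracTrunc_eq, abs_mul]
    calc _ ≤ |fracConst n α| *
          ((2 ^ ((n : ℝ) + α) * (‖x‖ ^ ((n : ℝ) + α))⁻¹) * ∫ y, |φ y|) := by gcongr; exact hb
      _ ≤ |fracConst n α| * ((2 ^ ((n : ℝ) + α) * ((1 + (2 * ρ)⁻¹) ^ ((n : ℝ) + α) *
          (1 + ‖x‖) ^ (-((n : ℝ) + α)))) * ∫ y, |φ y|) := by gcongr
      _ = D * (1 + ‖x‖) ^ (-((n : ℝ) + α)) := by simp only [D]; ring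
      _ ≤ _ := by gcongr; linarith [show 0 ≤ B * (1 + 2 * ρ) ^ ((n : ℝ) + α) by positivity]

lemma truncKernel_smul {r : ℝ} (hr : 0 < r) (δ : ℝ) (z : Rn n) :
    truncKernel α δ (r • z) = (r ^ ((n : ℝ) + α))⁻¹ * truncKernel α (δ / r) z := by
  have hz : ‖r • z‖ = r * ‖z‖ := by rw [norm_smul, Real.norm_of_nonneg hr.le]
  rcases le_or_gt (δ / r) ‖z‖ with h | h
  · have h' : δ ≤ ‖r • z‖ := by rw [hz]; rwa [div_le_iff₀' hr] at h
    rw [truncKernel_of_le h, truncKernel_of_le h', fracKernel, fracKernel, hz,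
      Real.mul_rpow hr.le (norm_nonneg z), mul_inv]
  · have h' : ‖r • z‖ < δ := by rw [hz]; rwa [lt_div_iff₀' hr] at h
    rw [truncKernel_of_lt h, truncKernel_of_lt h', mul_zero]

/-- Substituting `r z` for `z`, the kernel gives `r^{-n-α}` and the volume `r^n`. The truncation
radius changes as well, which is why the decay estimate has to be uniform in `δ`. -/
lemma fracTrunc_rescale {r : ℝ} (hr : 0 < r) (φ : Rn n → ℝ) (x₀ x : Rn n) (δ : ℝ) :
    fracTrunc α (fun y => φ (r⁻¹ • (y - x₀))) x δ =
      (r ^ α)⁻¹ * fracTrunc α φ (r⁻¹ • (x - x₀)) (δ / r) := by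
  rw [fracTrunc_eq, fracTrunc_eq]
  have h := Measure.integral_comp_smul (volume : Measure (Rn n)) (fun z => truncKernel α δ z *
    (φ (r⁻¹ • (x - x₀)) - φ (r⁻¹ • (x + z - x₀)))) r
  have e : ∀ z : Rn n, r⁻¹ • (x + r • z - x₀) = r⁻¹ • (x - x₀) + z := by
    intro z
    rw [show x + r • z - x₀ = (x - x₀) + r • z by abel, smul_add, smul_smul,
      inv_mul_cancel₀ hr.ne', one_smul]
  simp only [e, truncKernel_smul hr, finrank_euclideanSpace, Fintype.card_fin, smul_eq_mul,
    mul_assoc, integral_const_mul] at h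
  rw [abs_of_pos (by positivity)] at h
  have h2 : ∫ z : Rn n, truncKernel α δ z *
      (φ (r⁻¹ • (x - x₀)) - φ (r⁻¹ • (x + z - x₀))) = (r ^ α)⁻¹ * ∫ z : Rn n,
        truncKernel α (δ / r) z * (φ (r⁻¹ • (x - x₀)) - φ (r⁻¹ • (x - x₀) + z)) := by
    rw [Real.rpow_add hr, Real.rpow_natCast] at h
    have hrn : r ^ n ≠ 0 := by positivity
    field_simp at h ⊢
    linarith
  rw [h2]
  ring

/-- Symmetry is available for the truncated operators, where Fubini applies. This limit, dominated
on the support of `φ` by `exists_bound_fracTrunc`, transfers its consequences to the full operator.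
-/
lemma tendsto_integral_fracTrunc_mul (hn : 0 < n) (hα : 0 < α) {γ : ℝ} (hγ : α < γ)
    {u φ : Rn n → ℝ} (hu : Continuous u) (hL : MemLAlpha α u) (hu2 : LocSecondDiff γ u)
    (hφ : Continuous φ) (hs : HasCompactSupport φ) :
    Tendsto (fun δ => ∫ x, fracTrunc α u x δ * φ x) (𝓝[>] 0)
      (𝓝 (∫ x, fracLaplacian α u x * φ x)) := by
  obtain ⟨R, hR⟩ := hs.isCompact.isBounded.exists_norm_le
  obtain ⟨B, hB⟩ := exists_bound_fracTrunc hn hα hγ hu hL hu2 R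
  refine tendsto_integral_filter_of_dominated_convergence (fun x => B * |φ x|)
    (.of_forall fun δ => ((stronglyMeasurable_fracTrunc hu δ).mul
      hφ.stronglyMeasurable).aestronglyMeasurable) ?_
    ((hφ.integrable_of_hasCompactSupport hs).abs.const_mul B) (.of_forall fun x => ?_)
  · filter_upwards [self_mem_nhdsWithin] with δ hδ
    refine .of_forall fun x => ?_
    rw [norm_mul, Real.norm_eq_abs, Real.norm_eq_abs]
    by_cases hx : x ∈ tsupport φ
    · exact mul_le_mul_of_nonneg_right (hB x (hR x hx) δ hδ) (abs_nonneg _)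
    · simp [image_eq_zero_of_notMem_tsupport hx]
  · exact (hasFracLaplacianAt hn hα hγ hu hL hu2 x).2.mul_const _

/-- The averages of `(-Δ)^{α/2} u` against rescaled test functions tend to zero. -/
lemma tendsto_average_fracLaplacian (hn : 0 < n) (hα : 0 < α) (hα2 : α < 2) {γ : ℝ} (hγ : α < γ)
    {u φ : Rn n → ℝ} (hu : Continuous u) (hL : MemLAlpha α u) (hu2 : LocSecondDiff γ u)
    (hφ : ContDiff ℝ 2 φ) (hs : HasCompactSupport φ) (x₀ : Rn n) :
    Tendsto (fun r : ℝ => ∫ y, fracLaplacian α u (x₀ + r • y) * φ y) atTop (𝓝 0) := by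
  obtain ⟨A, hA⟩ := exists_decay_fracTrunc hn hα hα2 hφ hs
  have hw1 : Integrable fun z : Rn n => |u z| * (1 + ‖z - x₀‖) ^ (-((n : ℝ) + α)) := by
    have hm : Measurable fun z : Rn n => (1 + ‖z - x₀‖) ^ (-((n : ℝ) + α)) := by fun_prop
    refine Integrable.mono' (hL.const_mul (2 * (1 + ‖x₀‖) ^ ((n : ℝ) + α)))
      (hu.abs.aestronglyMeasurable.mul hm.aestronglyMeasurable) (.of_forall fun z => ?_)
    rw [Real.norm_of_nonneg (by positivity)]
    have := one_add_norm_rpow_le (s := (n : ℝ) + α) (by positivity) x₀ (z - x₀)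
    rw [add_sub_cancel] at this
    calc _ ≤ _ := mul_le_mul_of_nonneg_left this (abs_nonneg (u z))
      _ = _ := by ring
  have hA0 : 0 ≤ A := by
    have := (abs_nonneg _).trans (hA 0 1 one_pos)
    simpa using this
  have hmr : ∀ r : ℝ, Measurable fun z : Rn n => (r + ‖z - x₀‖) ^ (-((n : ℝ) + α)) :=
    fun r => by fun_prop
  have hle : ∀ r : ℝ, 1 ≤ r → ∀ z : Rn n,
      (r + ‖z - x₀‖) ^ (-((n : ℝ) + α)) ≤ (1 + ‖z - x₀‖) ^ (-((n : ℝ) + α)) := fun r hr z =>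
    Real.rpow_le_rpow_of_nonpos (by positivity) (by linarith) (by linarith [n.cast_nonneg (α := ℝ)])
  have hwr : ∀ r : ℝ, 1 ≤ r →
      Integrable fun z : Rn n => |u z| * (r + ‖z - x₀‖) ^ (-((n : ℝ) + α)) := by
    intro r hr
    refine Integrable.mono' hw1 (hu.abs.aestronglyMeasurable.mul (hmr r).aestronglyMeasurable)
      (.of_forall fun z => ?_)
    rw [Real.norm_of_nonneg (by positivity)]
    exact mul_le_mul_of_nonneg_left (hle r hr z) (abs_nonneg _)
  have hbound : ∀ r : ℝ, 1 ≤ r → ‖∫ y, fracLaplacian α u (x₀ + r • y) * φ y‖ ≤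
      A * ∫ z, |u z| * (r + ‖z - x₀‖) ^ (-((n : ℝ) + α)) := by
    intro r hr
    have hr0 : 0 < r := by linarith
    let ψ : Rn n → ℝ := fun y => φ (r⁻¹ • (y - x₀))
    have hψc : Continuous ψ := by have := hφ.continuous; fun_prop
    have hψs : HasCompactSupport ψ :=
      (hs.comp_homeomorph ((Homeomorph.subRight x₀).trans
        (Homeomorph.smulOfNeZero r⁻¹ (inv_ne_zero hr0.ne'))))
    have hsub : ∫ y, fracLaplacian α u (x₀ + r • y) * φ y =
        (r ^ n)⁻¹ * ∫ z, fracLaplacian α u z * ψ z := by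
      have h1 := Measure.integral_comp_smul (volume : Measure (Rn n))
        (fun z => fracLaplacian α u (x₀ + z) * ψ (x₀ + z)) r
      rw [integral_add_left_eq_self (fun z => fracLaplacian α u z * ψ z) x₀,
        abs_of_pos (by positivity), finrank_euclideanSpace, Fintype.card_fin, smul_eq_mul] at h1
      rw [← h1]
      refine integral_congr_ae (.of_forall fun y => ?_)
      simp only [ψ]
      rw [add_sub_cancel_left, smul_smul, inv_mul_cancel₀ hr0.ne', one_smul]
    have hδ : ∀ δ : ℝ, 0 < δ → ‖∫ x, fracTrunc α u x δ * ψ x‖ ≤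
        r ^ n * (A * ∫ z, |u z| * (r + ‖z - x₀‖) ^ (-((n : ℝ) + α))) := by
      intro δ hδ
      rw [integral_fracTrunc_mul hα hδ hu hL hψc hψs, ← mul_assoc, ← integral_const_mul]
      refine norm_integral_le_of_norm_le ((hwr r hr).const_mul _) (.of_forall fun z => ?_)
      have h1 := hA (r⁻¹ • (z - x₀)) (δ / r) (by positivity)
      -- The factor `r ^ n` produced here cancels the normalization `(r ^ n)⁻¹` of the average in
      -- `hsub`.
      have h2 : (r ^ α)⁻¹ * (1 + ‖r⁻¹ • (z - x₀)‖) ^ (-((n : ℝ) + α)) =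
          r ^ n * (r + ‖z - x₀‖) ^ (-((n : ℝ) + α)) := by
        have e1 : r + ‖z - x₀‖ = r * (1 + ‖r⁻¹ • (z - x₀)‖) := by
          rw [norm_smul, Real.norm_of_nonneg (by positivity)]
          field_simp
        rw [e1, Real.mul_rpow hr0.le (by positivity), Real.rpow_neg hr0.le, Real.rpow_add hr0,
          Real.rpow_natCast]
        field_simp
      rw [fracTrunc_rescale hr0, Real.norm_eq_abs, abs_mul, abs_mul,
        abs_of_nonneg (show 0 ≤ (r ^ α)⁻¹ by positivity)]
      calc _ ≤ |u z| * ((r ^ α)⁻¹ * (A * (1 + ‖r⁻¹ • (z - x₀)‖) ^ (-((n : ℝ) + α)))) := by gcongr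
        _ = |u z| * (A * ((r ^ α)⁻¹ * (1 + ‖r⁻¹ • (z - x₀)‖) ^ (-((n : ℝ) + α)))) := by ring
        _ = _ := by rw [h2]; ring
    have hlim := (tendsto_integral_fracTrunc_mul hn hα hγ hu hL hu2 hψc hψs).norm
    have hle2 := le_of_tendsto hlim (by
      filter_upwards [self_mem_nhdsWithin] with δ hδ0
      exact hδ δ hδ0)
    rw [hsub, norm_mul, norm_inv, Real.norm_of_nonneg (by positivity : (0 : ℝ) ≤ r ^ n),
      inv_mul_le_iff₀ (by positivity)]
    exact hle2
  have hzero : Tendsto (fun r : ℝ => A * ∫ z, |u z| * (r + ‖z - x₀‖) ^ (-((n : ℝ) + α)))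
      atTop (𝓝 0) := by
    rw [show (0 : ℝ) = A * ∫ z : Rn n, (0 : ℝ) by simp]
    refine Tendsto.const_mul _ ?_
    refine tendsto_integral_filter_of_dominated_convergence
      (fun z => |u z| * (1 + ‖z - x₀‖) ^ (-((n : ℝ) + α)))
      (.of_forall fun r => hu.abs.aestronglyMeasurable.mul (hmr r).aestronglyMeasurable) ?_ hw1
      (.of_forall fun z => ?_)
    · filter_upwards [eventually_ge_atTop 1] with r hr
      refine .of_forall fun z => ?_
      rw [Real.norm_of_nonneg (by positivity)]
      exact mul_le_mul_of_nonneg_left (hle r hr z) (abs_nonneg _)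
    · rw [show (0 : ℝ) = |u z| * 0 by simp]
      exact ((tendsto_rpow_neg_atTop (by positivity : 0 < (n : ℝ) + α)).comp
        (tendsto_atTop_add_const_right _ _ tendsto_id)).const_mul _
  refine squeeze_zero_norm' ?_ hzero
  filter_upwards [eventually_ge_atTop 1] with r hr using hbound r hr

end Averages

/-! ### Superharmonic functions with vanishing averages -/

section Laplacian

variable {n : ℕ}

/-- The `i`-th partial derivative. -/
def partialDeriv (i : Fin n) (f : Rn n → ℝ) (x : Rn n) : ℝ :=
  fderiv ℝ f x (EuclideanSpace.basisFun (Fin n) ℝ i)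

lemma ContDiff.partialDeriv {k : ℕ} {f : Rn n → ℝ} (hf : ContDiff ℝ ((k + 1 : ℕ)) f)
    (i : Fin n) : ContDiff ℝ (k : ℕ) (partialDeriv i f) :=
  (hf.fderiv_right (by norm_cast)).clm_apply contDiff_const

lemma HasCompactSupport.partialDeriv {f : Rn n → ℝ} (hf : HasCompactSupport f) (i : Fin n) :
    HasCompactSupport (partialDeriv i f) :=
  hf.fderiv_apply ℝ _

lemma laplacian_eq_sum {f : Rn n → ℝ} (hf : ContDiff ℝ 2 f) (x : Rn n) :
    Laplacian.laplacian f x = ∑ i, partialDeriv i (partialDeriv i f) x := by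
  rw [InnerProductSpace.laplacian_eq_iteratedFDeriv_orthonormalBasis f
    (EuclideanSpace.basisFun (Fin n) ℝ)]
  refine Finset.sum_congr rfl fun i _ => ?_
  have hd : DifferentiableAt ℝ (fderiv ℝ f) x :=
    ((hf.fderiv_right (m := 1) (by norm_num)).differentiable one_ne_zero) x
  rw [iteratedFDeriv_two_apply]
  change _ = fderiv ℝ (fun y => fderiv ℝ f y (EuclideanSpace.basisFun (Fin n) ℝ i)) x _
  rw [fderiv_clm_apply hd (differentiableAt_const _)]
  simp

lemma contDiff_laplacian {k : ℕ} {f : Rn n → ℝ} (hf : ContDiff ℝ ((k + 2 : ℕ)) f) :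
    ContDiff ℝ (k : ℕ) (Laplacian.laplacian f) := by
  have h2 : ContDiff ℝ 2 f := hf.of_le (by exact_mod_cast Nat.le_add_left 2 k)
  rw [show Laplacian.laplacian f = fun x => ∑ i, partialDeriv i (partialDeriv i f) x from
    funext (laplacian_eq_sum h2)]
  exact ContDiff.sum fun i _ => ContDiff.partialDeriv (ContDiff.partialDeriv (k := k + 1) hf i) i

lemma contDiff_negLaplacian {k : ℕ} {f : Rn n → ℝ} (hf : ContDiff ℝ ((k + 2 : ℕ)) f) :
    ContDiff ℝ (k : ℕ) (negLaplacian f) :=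
  (contDiff_laplacian hf).neg

lemma integral_partialDeriv_mul {f φ : Rn n → ℝ} (hf : ContDiff ℝ 1 f) (hφ : ContDiff ℝ 1 φ)
    (hs : HasCompactSupport φ) (i : Fin n) :
    ∫ x, partialDeriv i f x * φ x = -∫ x, f x * partialDeriv i φ x := by
  have cf : Continuous (partialDeriv i f) := (ContDiff.partialDeriv (k := 0) hf i).continuous
  have cφ : Continuous (partialDeriv i φ) := (ContDiff.partialDeriv (k := 0) hφ i).continuous
  rw [eq_neg_iff_add_eq_zero, add_comm, ← eq_neg_iff_add_eq_zero]
  exact integral_mul_fderiv_eq_neg_fderiv_mul_of_integrable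
    ((cf.mul hφ.continuous).integrable_of_hasCompactSupport hs.mul_left)
    ((hf.continuous.mul cφ).integrable_of_hasCompactSupport (hs.partialDeriv i).mul_left)
    ((hf.continuous.mul hφ.continuous).integrable_of_hasCompactSupport hs.mul_left)
    (fun x _ => hf.differentiable one_ne_zero x) (fun x _ => hφ.differentiable one_ne_zero x)

/-- Green's first identity against a test function. -/
lemma integral_laplacian_mul {f φ : Rn n → ℝ} (hf : ContDiff ℝ 2 f) (hφ : ContDiff ℝ 1 φ)
    (hs : HasCompactSupport φ) :
    ∫ x, Laplacian.laplacian f x * φ x = -∑ i, ∫ x, partialDeriv i f x * partialDeriv i φ x := by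
  have hi : ∀ i, ContDiff ℝ 1 (partialDeriv i f) := fun i => ContDiff.partialDeriv (k := 1) hf i
  have hii : ∀ i, Continuous (partialDeriv i (partialDeriv i f)) := fun i =>
    (ContDiff.partialDeriv (k := 0) (hi i) i).continuous
  simp_rw [laplacian_eq_sum hf, Finset.sum_mul]
  have hI : ∀ i, Integrable fun x => partialDeriv i (partialDeriv i f) x * φ x := fun i =>
    ((hii i).mul hφ.continuous).integrable_of_hasCompactSupport hs.mul_left
  rw [integral_finsetSum _ fun i _ => hI i, ← Finset.sum_neg_distrib]
  exact Finset.sum_congr rfl fun i _ => integral_partialDeriv_mul (hi i) hφ hs i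

lemma integral_laplacian_mul_eq {f φ : Rn n → ℝ} (hf : ContDiff ℝ 2 f) (hφ : ContDiff ℝ 2 φ)
    (hs : HasCompactSupport φ) :
    ∫ x, Laplacian.laplacian f x * φ x = ∫ x, f x * Laplacian.laplacian φ x := by
  have hi : ∀ i, ContDiff ℝ 1 (partialDeriv i φ) := fun i => ContDiff.partialDeriv (k := 1) hφ i
  have hii : ∀ i, Continuous (partialDeriv i (partialDeriv i φ)) := fun i =>
    (ContDiff.partialDeriv (k := 0) (hi i) i).continuous
  rw [integral_laplacian_mul hf (hφ.of_le one_le_two) hs, ← Finset.sum_neg_distrib]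
  simp_rw [laplacian_eq_sum hφ, Finset.mul_sum]
  have hI : ∀ i, Integrable fun x => f x * partialDeriv i (partialDeriv i φ) x := fun i =>
    (hf.continuous.mul (hii i)).integrable_of_hasCompactSupport
      ((hs.partialDeriv i).partialDeriv i).mul_left
  rw [integral_finsetSum _ fun i _ => hI i]
  refine Finset.sum_congr rfl fun i _ => ?_
  rw [integral_partialDeriv_mul (hf.of_le one_le_two) (hi i) (hs.partialDeriv i), neg_neg]

lemma partialDeriv_comp_affine {f : Rn n → ℝ} (hf : Differentiable ℝ f) (x₀ : Rn n) (r : ℝ)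
    (i : Fin n) (y : Rn n) :
    partialDeriv i (fun y => f (x₀ + r • y)) y = r * partialDeriv i f (x₀ + r • y) := by
  have h1 : HasFDerivAt (fun y : Rn n => x₀ + r • y) (r • ContinuousLinearMap.id ℝ (Rn n)) y :=
    ((hasFDerivAt_id y).const_smul r).const_add x₀
  have h2 := (hf (x₀ + r • y)).hasFDerivAt.comp y h1
  rw [partialDeriv, show fderiv ℝ (fun y => f (x₀ + r • y)) y = _ from h2.fderiv]
  simp [partialDeriv]

lemma contDiff_comp_affine {k : WithTop ℕ∞} {f : Rn n → ℝ} (hf : ContDiff ℝ k f) (x₀ : Rn n)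
    (r : ℝ) : ContDiff ℝ k fun y => f (x₀ + r • y) :=
  hf.comp (contDiff_const.add (contDiff_id.const_smul r))

lemma laplacian_comp_affine {f : Rn n → ℝ} (hf : ContDiff ℝ 2 f) (x₀ : Rn n) (r : ℝ) (y : Rn n) :
    Laplacian.laplacian (fun y => f (x₀ + r • y)) y =
      r ^ 2 * Laplacian.laplacian f (x₀ + r • y) := by
  rw [laplacian_eq_sum (contDiff_comp_affine hf x₀ r), laplacian_eq_sum hf, Finset.mul_sum]
  refine Finset.sum_congr rfl fun i _ => ?_
  have hi : ContDiff ℝ 1 (partialDeriv i f) := ContDiff.partialDeriv (k := 1) hf i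
  have e : partialDeriv i (fun y => f (x₀ + r • y)) =
      fun y => r * partialDeriv i f (x₀ + r • y) :=
    funext (partialDeriv_comp_affine (hf.differentiable two_ne_zero) x₀ r i)
  have hd : DifferentiableAt ℝ (fun y => partialDeriv i f (x₀ + r • y)) y :=
    ((contDiff_comp_affine hi x₀ r).differentiable one_ne_zero) y
  rw [e, partialDeriv, fderiv_const_mul hd]
  change r * partialDeriv i (fun y => partialDeriv i f (x₀ + r • y)) y = _
  rw [partialDeriv_comp_affine (hi.differentiable one_ne_zero)]
  ring

/-- The averages of `f` against every rescaled test function tend to zero. -/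
def VanishingAverages (f : Rn n → ℝ) : Prop :=
  ∀ φ : Rn n → ℝ, ContDiff ℝ (⊤ : ℕ∞) φ → HasCompactSupport φ → ∀ x₀ : Rn n,
    Tendsto (fun r : ℝ => ∫ y, f (x₀ + r • y) * φ y) atTop (𝓝 0)

lemma VanishingAverages.negLaplacian {f : Rn n → ℝ} (hf : ContDiff ℝ 2 f)
    (h : VanishingAverages f) : VanishingAverages (negLaplacian f) := by
  intro φ hφ hs x₀
  have hφ2 : ContDiff ℝ 2 φ := contDiff_infty.1 hφ 2
  have hΔ : ContDiff ℝ (⊤ : ℕ∞) (Laplacian.laplacian φ) := by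
    rw [contDiff_infty]
    exact fun k => contDiff_laplacian (contDiff_infty.1 hφ (k + 2))
  have hΔs : HasCompactSupport (Laplacian.laplacian φ) := by
    rw [show Laplacian.laplacian φ = fun x => ∑ i, partialDeriv i (partialDeriv i φ) x from
      funext (laplacian_eq_sum hφ2)]
    refine HasCompactSupport.of_support_subset_isCompact hs.isCompact fun x hx => ?_
    by_contra hx'
    refine hx (Finset.sum_eq_zero fun i _ => image_eq_zero_of_notMem_tsupport fun hx2 => hx' ?_)
    exact tsupport_fderiv_apply_subset ℝ _ (tsupport_fderiv_apply_subset ℝ _ hx2)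
  have h1 := ((tendsto_pow_atTop two_ne_zero).inv_tendsto_atTop (𝕜 := ℝ)).mul
    (h _ hΔ hΔs x₀).neg
  rw [neg_zero, zero_mul] at h1
  refine h1.congr' ?_
  filter_upwards [eventually_gt_atTop 0] with r hr
  rw [Pi.inv_apply, ← integral_laplacian_mul_eq (contDiff_comp_affine hf x₀ r) hφ2 hs,
    ← integral_neg, ← integral_const_mul]
  refine integral_congr_ae (.of_forall fun y => ?_)
  simp only [laplacian_comp_affine hf, _root_.negLaplacian]
  field_simp

lemma hasDerivAt_expNegInvGlue (x : ℝ) :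
    HasDerivAt expNegInvGlue ((x⁻¹) ^ 2 * expNegInvGlue x) x := by
  simpa using expNegInvGlue.hasDerivAt_polynomial_eval_inv_mul 1 x

/-- The test function `h(|y|²)` with `h(t) = exp(-1/(1-t))` for `t < 1`. -/
def radialPotential (y : Rn n) : ℝ := expNegInvGlue (1 - ‖y‖ ^ 2)

/-- The density `-2h'(|y|²)`, so that `∇ h(|y|²) = -y (-2h'(|y|²))`. -/
def radialWeight (y : Rn n) : ℝ := 2 * deriv expNegInvGlue (1 - ‖y‖ ^ 2)

lemma radialWeight_eq (y : Rn n) :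
    radialWeight y = 2 * (((1 - ‖y‖ ^ 2)⁻¹) ^ 2 * expNegInvGlue (1 - ‖y‖ ^ 2)) := by
  rw [radialWeight, (hasDerivAt_expNegInvGlue _).deriv]

lemma radialWeight_nonneg (y : Rn n) : 0 ≤ radialWeight y := by
  have := expNegInvGlue.nonneg (1 - ‖y‖ ^ 2)
  rw [radialWeight_eq]; positivity

lemma contDiff_radialPotential : ContDiff ℝ (⊤ : ℕ∞) (radialPotential : Rn n → ℝ) :=
  expNegInvGlue.contDiff.comp (contDiff_const.sub (contDiff_id.norm_sq ℝ))

lemma contDiff_radialWeight : ContDiff ℝ (⊤ : ℕ∞) (radialWeight : Rn n → ℝ) := by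
  have h : ContDiff ℝ (⊤ : ℕ∞) (deriv expNegInvGlue) :=
    (contDiff_infty_iff_deriv.1 expNegInvGlue.contDiff).2
  exact contDiff_const.mul (h.comp (contDiff_const.sub (contDiff_id.norm_sq ℝ)))

lemma norm_le_of_expNegInvGlue_ne_zero {y : Rn n} (h : expNegInvGlue (1 - ‖y‖ ^ 2) ≠ 0) :
    ‖y‖ ≤ 1 := by
  by_contra! hy
  exact h (expNegInvGlue.zero_of_nonpos (by nlinarith))

lemma hasCompactSupport_radialPotential : HasCompactSupport (radialPotential : Rn n → ℝ) :=
  HasCompactSupport.of_support_subset_isCompact (isCompact_closedBall 0 1) fun y hy => by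
    simpa using norm_le_of_expNegInvGlue_ne_zero hy

lemma norm_le_one_of_radialWeight_ne_zero {y : Rn n} (h : radialWeight y ≠ 0) : ‖y‖ ≤ 1 :=
  norm_le_of_expNegInvGlue_ne_zero fun h0 => h (by rw [radialWeight_eq, h0]; simp)

lemma hasCompactSupport_radialWeight : HasCompactSupport (radialWeight : Rn n → ℝ) :=
  HasCompactSupport.of_support_subset_isCompact (isCompact_closedBall 0 1) fun y hy => by
    simpa using norm_le_one_of_radialWeight_ne_zero hy

lemma integral_radialWeight_pos : 0 < ∫ y : Rn n, radialWeight y := by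
  refine contDiff_radialWeight.continuous.integral_pos_of_hasCompactSupport_nonneg_nonzero
    hasCompactSupport_radialWeight radialWeight_nonneg (x := 0) ?_
  rw [radialWeight_eq]
  have := expNegInvGlue.pos_of_pos one_pos
  simp [this.ne']

lemma partialDeriv_radialPotential (i : Fin n) (y : Rn n) :
    partialDeriv i radialPotential y = -(y i * radialWeight y) := by
  have h1 : HasFDerivAt (fun y : Rn n => 1 - ‖y‖ ^ 2) (-(2 • innerSL ℝ y)) y :=
    (hasStrictFDerivAt_norm_sq y).hasFDerivAt.const_sub 1
  have h2 := (hasDerivAt_expNegInvGlue (1 - ‖y‖ ^ 2)).comp_hasFDerivAt y h1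
  rw [partialDeriv, show fderiv ℝ radialPotential y = _ from h2.fderiv, radialWeight_eq]
  simp [EuclideanSpace.inner_single_right]
  ring

/-- Averages of a `C¹` function can be differentiated in the scale. -/
lemma hasDerivAt_radialAverage {f : Rn n → ℝ} (hf : ContDiff ℝ 1 f) (x₀ : Rn n) (r : ℝ) :
    HasDerivAt (fun r : ℝ => ∫ y, f (x₀ + r • y) * radialWeight y)
      (∫ y, fderiv ℝ f (x₀ + r • y) y * radialWeight y) r := by
  obtain ⟨C, hC⟩ := (isCompact_closedBall (0 : Rn n) (‖x₀‖ + (|r| + 1))).exists_bound_of_continuousOn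
    (hf.continuous_fderiv one_ne_zero).continuousOn
  have cφ : Continuous (radialWeight : Rn n → ℝ) := contDiff_radialWeight.continuous
  have cf := hf.continuous
  have cf' : Continuous fun y : Rn n => fderiv ℝ f (x₀ + r • y) y :=
    ((hf.continuous_fderiv one_ne_zero).comp (by fun_prop)).clm_apply continuous_id
  refine (hasDerivAt_integral_of_dominated_loc_of_deriv_le (Metric.ball_mem_nhds r one_pos)
    (bound := fun y => C * ‖radialWeight y‖)
    (F' := fun r y => fderiv ℝ f (x₀ + r • y) y * radialWeight y)
    (.of_forall fun t => ?_) ?_ (cf'.mul cφ).aestronglyMeasurable (.of_forall fun y t ht => ?_) ?_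
    (.of_forall fun y t _ => ?_)).2
  · exact ((cf.comp (by fun_prop)).mul cφ).aestronglyMeasurable
  · exact ((cf.comp (by fun_prop)).mul cφ).integrable_of_hasCompactSupport
      hasCompactSupport_radialWeight.mul_left
  · rw [norm_mul]
    by_cases h0 : radialWeight y = 0
    · simp [h0]
    · have hy := norm_le_one_of_radialWeight_ne_zero h0
      refine mul_le_mul_of_nonneg_right ?_ (norm_nonneg _)
      have ht1 : |t| ≤ |r| + 1 := by
        rw [Metric.mem_ball, Real.dist_eq] at ht
        have := abs_sub_abs_le_abs_sub t r
        linarith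
      have hmem : x₀ + t • y ∈ Metric.closedBall (0 : Rn n) (‖x₀‖ + (|r| + 1)) := by
        rw [mem_closedBall_zero_iff]
        refine (norm_add_le _ _).trans (add_le_add le_rfl ?_)
        rw [norm_smul, Real.norm_eq_abs]
        exact (mul_le_of_le_one_right (abs_nonneg t) hy).trans ht1
      calc _ ≤ ‖fderiv ℝ f (x₀ + t • y)‖ * ‖y‖ := ContinuousLinearMap.le_opNorm _ _
        _ ≤ ‖fderiv ℝ f (x₀ + t • y)‖ := mul_le_of_le_one_right (norm_nonneg _) hy
        _ ≤ C := hC _ hmem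
  · exact (cφ.norm.integrable_of_hasCompactSupport
      hasCompactSupport_radialWeight.norm).const_mul C
  · have h1 : HasDerivAt (fun t : ℝ => x₀ + t • y) y t := by
      simpa using ((hasDerivAt_id t).smul_const y).const_add x₀
    exact ((hf.differentiable one_ne_zero _).hasFDerivAt.comp_hasDerivAt t h1).mul_const _

/-- The weight was chosen so that `∇Φ = -y W`, with `Φ` the radial potential and `W` the weight.
Integration by parts then expresses the radial derivative of the average through `Δf` tested against
`Φ ≥ 0`, which fixes its sign for superharmonic `f`. -/
lemma integral_fderiv_radialWeight {f : Rn n → ℝ} (hf : ContDiff ℝ 2 f) (x₀ : Rn n) {r : ℝ}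
    (hr : r ≠ 0) :
    ∫ y, fderiv ℝ f (x₀ + r • y) y * radialWeight y =
      r * ∫ y, Laplacian.laplacian f (x₀ + r • y) * radialPotential y := by
  have hΦ : ContDiff ℝ 1 (radialPotential : Rn n → ℝ) :=
    contDiff_infty.1 contDiff_radialPotential 1
  have h := integral_laplacian_mul (contDiff_comp_affine hf x₀ r) hΦ
    hasCompactSupport_radialPotential
  have hf1 : Differentiable ℝ f := hf.differentiable two_ne_zero
  have ci : ∀ i, Continuous fun y => partialDeriv i f (x₀ + r • y) * (y i * radialWeight y) := by
    intro i
    have c1 : Continuous (partialDeriv i f) := (ContDiff.partialDeriv (k := 1) hf i).continuous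
    have c2 : Continuous (radialWeight : Rn n → ℝ) := contDiff_radialWeight.continuous
    fun_prop
  have e1 : ∀ y : Rn n, fderiv ℝ f (x₀ + r • y) y * radialWeight y =
      ∑ i, partialDeriv i f (x₀ + r • y) * (y i * radialWeight y) := by
    intro y
    have hy : y = ∑ i, y i • EuclideanSpace.basisFun (Fin n) ℝ i := by
      simpa using ((EuclideanSpace.basisFun (Fin n) ℝ).sum_repr y).symm
    conv_lhs => rw [show fderiv ℝ f (x₀ + r • y) y =
      fderiv ℝ f (x₀ + r • y) (∑ i, y i • EuclideanSpace.basisFun (Fin n) ℝ i) by rw [← hy]]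
    rw [map_sum, Finset.sum_mul]
    refine Finset.sum_congr rfl fun i _ => ?_
    rw [map_smul, smul_eq_mul, partialDeriv]
    ring
  have e2 : ∀ i, ∫ y, partialDeriv i (fun y => f (x₀ + r • y)) y * partialDeriv i radialPotential y =
      -(r * ∫ y, partialDeriv i f (x₀ + r • y) * (y i * radialWeight y)) := by
    intro i
    rw [← integral_const_mul, ← integral_neg]
    refine integral_congr_ae (.of_forall fun y => ?_)
    simp only [partialDeriv_comp_affine hf1, partialDeriv_radialPotential]
    ring
  have e3 : ∫ y, Laplacian.laplacian (fun y => f (x₀ + r • y)) y * radialPotential y =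
      r ^ 2 * ∫ y, Laplacian.laplacian f (x₀ + r • y) * radialPotential y := by
    rw [← integral_const_mul]
    refine integral_congr_ae (.of_forall fun y => ?_)
    simp only [laplacian_comp_affine hf, mul_assoc]
  have hI : ∀ i, Integrable fun y => partialDeriv i f (x₀ + r • y) * (y i * radialWeight y) :=
    fun i => (ci i).integrable_of_hasCompactSupport
      (HasCompactSupport.mul_left (HasCompactSupport.mul_left hasCompactSupport_radialWeight))
  rw [e3, Finset.sum_congr rfl fun i _ => e2 i, Finset.sum_neg_distrib, neg_neg,
    ← Finset.mul_sum] at h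
  rw [integral_congr_ae (.of_forall e1), integral_finsetSum _ fun i _ => hI i]
  -- Green's identity for `y ↦ f(x₀ + r y)` carries `r²` on the Laplacian side and `r` on the
  -- gradient side.
  refine mul_left_cancel₀ hr ?_
  rw [← h]
  ring

/-- A superharmonic function with vanishing averages is nonnegative. -/
lemma VanishingAverages.nonneg {f : Rn n → ℝ} (hf : ContDiff ℝ 2 f) (h : VanishingAverages f)
    (hsup : ∀ x, 0 ≤ _root_.negLaplacian f x) (x₀ : Rn n) : 0 ≤ f x₀ := by
  let M : ℝ → ℝ := fun r => ∫ y, f (x₀ + r • y) * radialWeight y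
  have hd := hasDerivAt_radialAverage (hf.of_le one_le_two) x₀
  have hanti : AntitoneOn M (Set.Ici 0) := by
    refine antitoneOn_of_deriv_nonpos (convex_Ici 0)
      (fun r _ => (hd r).continuousAt.continuousWithinAt)
      (fun r _ => (hd r).differentiableAt.differentiableWithinAt) fun r hr => ?_
    rw [interior_Ici, Set.mem_Ioi] at hr
    rw [(hd r).deriv, integral_fderiv_radialWeight hf x₀ hr.ne']
    refine mul_nonpos_of_nonneg_of_nonpos hr.le (integral_nonpos fun y => ?_)
    exact mul_nonpos_of_nonpos_of_nonneg (neg_nonneg.1 (hsup _)) (expNegInvGlue.nonneg _)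
  have hlim : Tendsto M atTop (𝓝 0) :=
    h radialWeight contDiff_radialWeight hasCompactSupport_radialWeight x₀
  -- `M` decreases from `M 0` to its limit `0`; at scale zero the average is `f x₀` times the
  -- positive mass of the weight.
  have h0 : 0 ≤ M 0 := le_of_tendsto hlim (by
    filter_upwards [eventually_ge_atTop 0] with r hr
    exact hanti Set.self_mem_Ici hr hr)
  have hM0 : M 0 = f x₀ * ∫ y : Rn n, radialWeight y := by
    simp [M, integral_const_mul]
  rw [hM0] at h0
  exact nonneg_of_mul_nonneg_left h0 integral_radialWeight_pos

lemma contDiff_iterate_negLaplacian {f : Rn n → ℝ} (i k : ℕ)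
    (hf : ContDiff ℝ ((k + 2 * i : ℕ)) f) : ContDiff ℝ (k : ℕ) (negLaplacian^[i] f) := by
  induction i generalizing k with
  | zero => simpa using hf
  | succ i ih =>
    rw [Function.iterate_succ_apply']
    exact contDiff_negLaplacian (ih (k + 2) (by convert hf using 2; ring))

lemma VanishingAverages.iterate_negLaplacian {f : Rn n → ℝ} (h : VanishingAverages f) (i : ℕ)
    (hf : ContDiff ℝ ((2 * i : ℕ)) f) : VanishingAverages (_root_.negLaplacian^[i] f) := by
  induction i with
  | zero => exact h
  | succ i ih =>
    rw [Function.iterate_succ_apply']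
    refine (ih (hf.of_le (by norm_cast; omega))).negLaplacian ?_
    exact contDiff_iterate_negLaplacian i 2 (by convert hf using 2; ring)

/-- If `f` has vanishing averages and `(-Δ)^m f ≥ 0`, then `(-Δ)^i f ≥ 0` for all `i ≤ m`. -/
lemma VanishingAverages.iterate_negLaplacian_nonneg {f : Rn n → ℝ} (h : VanishingAverages f)
    {m : ℕ} (hf : ContDiff ℝ ((2 * m : ℕ)) f) (hm : ∀ x, 0 ≤ _root_.negLaplacian^[m] f x) {i : ℕ}
    (hi : i ≤ m) (x : Rn n) : 0 ≤ _root_.negLaplacian^[i] f x := by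
  induction hi using Nat.decreasingInduction generalizing x with
  | self => exact hm x
  | of_succ i hi ih =>
    -- Nonnegativity at level `i + 1` says that the `i`-th iterate is superharmonic.
    refine (h.iterate_negLaplacian i (hf.of_le (by norm_cast; omega))).nonneg
      (contDiff_iterate_negLaplacian i 2 (hf.of_le (by norm_cast; omega))) (fun y => ?_) x
    rw [← Function.iterate_succ_apply' (_root_.negLaplacian)]
    exact ih y

end Laplacian

end

theorem theorem1p1 (n m : ℕ) (hn : 2 ≤ n) (hm : 1 ≤ m)
    (α : ℝ) (hα0 : 0 < α) (hα2 : α < 2)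
    (ε : ℝ) (hε : 0 < ε) (hε1 : Int.fract α + ε ≤ 1)
    (u : Rn n → ℝ)
    (hu_reg : IsLocHolder (2 * m + ⌊α⌋₊) (Int.fract α + ε) u)
    (hu_L : MemLAlpha α u)
    (hu_nonneg : ∀ x, 0 ≤ u x)
    (f : Rn n → JetValue n (2 * m + ⌊α⌋₊) → ℝ)
    (hf_cont : Continuous fun x => f x (jet (2 * m + ⌊α⌋₊) u x))
    (hf_nonneg : ∀ x, 0 ≤ f x (jet (2 * m + ⌊α⌋₊) u x))
    (hu_eq : ∀ x, higherFracLaplacian m α u x = f x (jet (2 * m + ⌊α⌋₊) u x)) :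
    (∀ x, HasFracLaplacianAt α u x (fracLaplacian α u x)) ∧
      ContDiff ℝ ((2 * m : ℕ)) (fracLaplacian α u) ∧
      ∀ i : ℕ, i < m → ∀ x, 0 ≤ higherFracLaplacian i α u x := by
  have hn0 : 0 < n := by omega
  have hfloor : ⌊α⌋₊ ≤ 1 := Nat.lt_succ_iff.1 ((Nat.floor_lt hα0.le).2 (by exact_mod_cast hα2))
  have hβ : 0 < Int.fract α + ε := by linarith [Int.fract_nonneg α]
  -- The right side equals `α + ε`: the extra Hölder exponent `ε` is what makes the singular
  -- integral converge absolutely.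
  have hlt : α < ⌊α⌋₊ + (Int.fract α + ε) := by
    have h1 : ((⌊α⌋₊ : ℕ) : ℝ) = (⌊α⌋ : ℝ) := natCast_floor_eq_intCast_floor hα0.le
    have h2 := Int.floor_add_fract α
    linarith
  have hreg : LocHolder (2 * m + ⌊α⌋₊) (Int.fract α + ε) u := hu_reg
  have hu2 := hreg.locSecondDiff_of_add hfloor hβ hε1
  have huc : Continuous u := hreg.1.continuous
  have hw := contDiff_fracLaplacian hn0 hα0 hfloor hβ hε1 hlt hreg hu_L
  have hav : VanishingAverages (fracLaplacian α u) := fun φ hφ hs x₀ =>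
    tendsto_average_fracLaplacian hn0 hα0 hα2 hlt huc hu_L hu2
      (contDiff_infty.1 hφ 2) hs x₀
  refine ⟨hasFracLaplacianAt hn0 hα0 hlt huc hu_L hu2, hw, fun i hi x => ?_⟩
  exact hav.iterate_negLaplacian_nonneg hw (fun y => (hf_nonneg y).trans_eq (hu_eq y).symm) hi.le x
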